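/- Let $m\ge 1$. Let $\Omega\mathbb{RP}^m$ be the space of continuous maps $f:\mathbb{RP}^1\to\mathbb{RP}^m$ with $f(\infty)=[1:\dots:1]$, where $\mathbb{RP}^1=\mathbb{R}\cup\{\infty\}$, with the compact-open topology. For $n\ge 0$ let $\mathrm{RRat}_n(m)\subset\Omega\mathbb{RP}^m$ be the set of maps of the form $x\mapsto[p_0(x):\dots:p_m(x)]$ $(x\in\mathbb{R})$, where $p_0,\dots,p_m$ are monic real polynomials of degree $n$ with no common root in $\mathbb{C}$. (These are the restrictions to $\mathbb{RP}^1$ of the base-point preserving rational maps $\mathbb{CP}^1\to\mathbb{CP}^m$ of degree $n$ which commute with complex conjugation.) Let $\mathrm{Rat}_n(\mathbb{RP}^m)$ be the closure of $\mathrm{RRat}_n(m)$ in $\Omega\mathbb{RP}^m$, with the subspace topology; then $\mathrm{Rat}_n(\mathbb{RP}^m)\subset\mathrm{Rat}_{n+2}(\mathbb{RP}^m)$. Let $\mathrm{Rat}_{\mathrm{ev}}(\mathbb{RP}^m)$ and $\mathrm{Rat}_{\mathrm{odd}}(\mathbb{RP}^m)$ be the direct limits, with the direct limit topology, of the sequences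 of inclusions $\mathrm{Rat}_0\subset\mathrm{Rat}_2\subset\mathrm{Rat}_4\subset\cdots$ and $\mathrm{Rat}_1\subset\mathrm{Rat}_3\subset\mathrm{Rat}_5\subset\cdots$, and let $\mathrm{Rat}_\infty(\mathbb{RP}^m)=\mathrm{Rat}_{\mathrm{ev}}(\mathbb{RP}^m)\sqcup\mathrm{Rat}_{\mathrm{odd}}(\mathbb{RP}^m)$. Then the natural inclusion \[\mathrm{Rat}_\infty(\mathbb{RP}^m)\hookrightarrow\Omega\mathbb{RP}^m\] (which sends every rational map to itself) is a homotopy equivalence. -/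

import Mathlib

open scoped LinearAlgebra.Projectivization ContinuousMap
open Polynomial

namespace RationalLoops

/-- Real projective `m`-space: the lines through the origin of `ℝ^(m+1)`. -/
abbrev RP (m : ℕ) : Type := ℙ ℝ (Fin (m + 1) → ℝ)

/-- The usual topology of `RP m`: the quotient topology from `ℝ^(m+1)` minus the origin. -/
noncomputable instance instTopologicalSpaceRP (m : ℕ) : TopologicalSpace (RP m) :=
  TopologicalSpace.coinduced
    (Projectivization.mk' ℝ : {v : Fin (m + 1) → ℝ // v ≠ 0} → RP m) inferInstance

/-- The point `[x : 1]` of the affine piece of `RP 1`. -/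
noncomputable def affinePoint (x : ℝ) : RP 1 :=
  Projectivization.mk ℝ ![x, 1] (fun h => one_ne_zero (congrFun h 1))

/-- The base point `∞ = [1 : 0]` of `RP 1`. -/
noncomputable def infinityPoint : RP 1 :=
  Projectivization.mk ℝ ![1, 0] (fun h => one_ne_zero (congrFun h 0))

/-- The base point `[1 : 1 : ⋯ : 1]` of `RP m`. -/
noncomputable def basePoint (m : ℕ) : RP m :=
  Projectivization.mk ℝ (fun _ => 1) (fun h => one_ne_zero (congrFun h 0))

/-- The loop space `Ω RP^m`: continuous maps `RP^1 → RP^m` that preserve base points,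
with the compact-open topology. -/
abbrev LoopSpace (m : ℕ) : Type := {f : C(RP 1, RP m) // f infinityPoint = basePoint m}

/-- The restrictions to `RP^1` of the base-point preserving rational maps `CP^1 → CP^m` of
degree `n` which commute with complex conjugation. As `∞` goes to `[1 : ⋯ : 1]`, such a map is
`x ↦ [p₀(x) : ⋯ : p_m(x)]` with real monic polynomials `pᵢ` of degree `n` that have no common
root in `ℂ`. -/
def RRat (n m : ℕ) : Set (LoopSpace m) :=
  {f | ∃ p : Fin (m + 1) → ℝ[X],
    (∀ i, (p i).Monic ∧ (p i).natDegree = n) ∧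
    (∀ z : ℂ, ∃ i, aeval z (p i) ≠ 0) ∧
    ∀ x : ℝ, ∃ h : (fun i => (p i).eval x) ≠ 0,
      f.1 (affinePoint x) = Projectivization.mk ℝ (fun i => (p i).eval x) h}

/-- The space of real rational maps: the closure of `RRat n m` in the loop space. -/
def rat (n m : ℕ) : Set (LoopSpace m) := closure (RRat n m)

/-- The direct limit of an increasing sequence `A 0 ⊆ A 1 ⊆ ⋯` of subspaces of `X`: as a set it
is the union of the `A k`. -/
def SeqLimit {X : Type*} (A : ℕ → Set X) : Type _ := {x : X // ∃ k, x ∈ A k}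

namespace SeqLimit

variable {X : Type*} {A : ℕ → Set X}

/-- The canonical map of the `k`-th stage to the direct limit. -/
def of (A : ℕ → Set X) (k : ℕ) (x : A k) : SeqLimit A := ⟨x.1, k, x.2⟩

/-- The inclusion of the direct limit in the ambient space, as a map of sets. -/
def val (x : SeqLimit A) : X := x.1

/-- The direct limit topology: the finest one that makes all maps `of A k` continuous, each
`A k` having the subspace topology. (In general it is finer than the subspace topology of the
union.) -/
instance [TopologicalSpace X] : TopologicalSpace (SeqLimit A) :=
  ⨆ k, TopologicalSpace.coinduced (of A k) inferInstance

theorem continuous_val [TopologicalSpace X] : Continuous (val : SeqLimit A → X) :=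
  continuous_iSup_dom.2 fun _ => continuous_coinduced_dom.2 continuous_subtype_val

end SeqLimit

/-- The direct limit of `rat 0 m ⊆ rat 2 m ⊆ rat 4 m ⊆ ⋯`. -/
abbrev RatEven (m : ℕ) : Type := SeqLimit fun k => rat (2 * k) m

/-- The direct limit of `rat 1 m ⊆ rat 3 m ⊆ rat 5 m ⊆ ⋯`. -/
abbrev RatOdd (m : ℕ) : Type := SeqLimit fun k => rat (2 * k + 1) m

/-- The stabilized space of rational maps: the disjoint union of the even and the odd one. -/
abbrev RatInfinity (m : ℕ) : Type := RatEven m ⊕ RatOdd m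

/-- The natural inclusion `Rat_∞(RP^m) → Ω RP^m`, which sends a rational map to itself. -/
noncomputable def ratInclusion (m : ℕ) : C(RatInfinity m, LoopSpace m) where
  toFun := Sum.elim SeqLimit.val SeqLimit.val
  continuous_toFun := SeqLimit.continuous_val.sumElim SeqLimit.continuous_val

end RationalLoops

namespace RationalLoops

/-! Dividing the homogenization of a degree `n` tuple by the `n`-th power of the Euclidean norm
gives a vector-valued function on the punctured plane. Since the homogenization of `x ^ 2 + 1` is
the squared norm, multiplying the tuple by it leaves this function unchanged. All degrees of one
parity thus live compatibly in a single real vector space, where monic tuples of degree `n` form an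
affine subspace.

Three facts carry the proof. Convexity (`convex_nearForms`): the forms of degree `n` whose loop is
uniformly close to a given loop form a convex set, since near a line the admissible vectors fill one
half of a double cone. Density (`exists_mem_RRat_dist_lt`): every loop is a limit of rational loops,
by Stone-Weierstrass. Parity (`even_add_of_dist_le_one`): rational loops at distance at most `1`
have degrees of the same parity.

Let `approxDegree f δ` be the least degree of a rational loop `δ`-close to `f`. Selecting
continuously from convex sets gives, for `t` in `(0, 1]`, a loop `H (t, f)` within `t / 2` of `f`
lying in `rat (approxDegree f (t / 8)) m`; it extends continuously by `f` at `t = 0`. If `f` is in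
`rat n m`, the least degree is at most `n` and has its parity, so `H` preserves every stage. At `t =
1` the least degree is locally bounded with constant parity, so `H (1, ·)` locally lands in one
stage and is continuous into the direct limit. This is the homotopy inverse, and `H` supplies both
homotopies. -/

open Set Topology Filter

/-! ### Projective space as an open quotient, and its chordal metric -/

/-- Real `k`-space without the origin. -/
abbrev Punctured (k : ℕ) : Type := {v : Fin k → ℝ // v ≠ 0}

theorem mk'_eq_mk'_iff {k : ℕ} (v w : Punctured k) :
    Projectivization.mk' ℝ v = Projectivization.mk' ℝ w ↔ ∃ a : ℝ, a • w.1 = v.1 := by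
  rw [Projectivization.mk'_eq_mk, Projectivization.mk'_eq_mk, Projectivization.mk_eq_mk_iff']

theorem isOpenQuotientMap_mk' (m : ℕ) :
    IsOpenQuotientMap (Projectivization.mk' ℝ : Punctured (m + 1) → RP m) := by
  refine ⟨fun x => ⟨⟨x.rep, x.rep_nonzero⟩, x.mk_rep⟩, continuous_coinduced_rng, ?_⟩
  intro U hU
  rw [isOpen_coinduced]
  have : (Projectivization.mk' ℝ : Punctured (m + 1) → RP m) ⁻¹' (Projectivization.mk' ℝ '' U)
      = ⋃ a : ℝˣ, (fun v : Punctured (m + 1) =>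
        (⟨a • v.1, (smul_ne_zero_iff_ne a).2 v.2⟩ : Punctured (m + 1))) ⁻¹' U := by
    ext v
    simp only [mem_preimage, mem_image, mem_iUnion]
    constructor
    · rintro ⟨w, hw, h⟩
      obtain ⟨a, ha⟩ := (mk'_eq_mk'_iff _ _).1 h
      have ha0 : a ≠ 0 := by
        rintro rfl
        exact w.2 (by rw [← ha, zero_smul])
      refine ⟨Units.mk0 a ha0, ?_⟩
      convert hw using 1
      exact Subtype.ext ha
    · rintro ⟨a, ha⟩
      exact ⟨_, ha, (mk'_eq_mk'_iff _ _).2 ⟨a, rfl⟩⟩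
  rw [this]
  refine isOpen_iUnion fun a => hU.preimage ?_
  exact Continuous.subtype_mk (continuous_subtype_val.const_smul a) _

theorem dotProduct_self_pos {k : ℕ} {v : Fin k → ℝ} (hv : v ≠ 0) : 0 < v ⬝ᵥ v := by
  have h : 0 ≤ v ⬝ᵥ v := Finset.sum_nonneg fun i _ => mul_self_nonneg _
  exact h.lt_of_ne fun h' => hv (dotProduct_self_eq_zero.1 h'.symm)

/-- The orthogonal projection to the line spanned by `v`, as a list of matrix entries. -/
noncomputable def projectionEntries {k : ℕ} (v : Fin k → ℝ) :
    EuclideanSpace ℝ (Fin k × Fin k) :=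
  WithLp.toLp 2 fun ij => v ij.1 * v ij.2 / (v ⬝ᵥ v)

/-- The right side is twice the squared sine of the angle between the two lines. Hence distance at
most `1` means an angle of at most 45 degrees, the source of the threshold `1` used throughout. -/
theorem dist_projectionEntries_sq {k : ℕ} {u w : Fin k → ℝ} (hu : u ≠ 0) (hw : w ≠ 0) :
    dist (projectionEntries u) (projectionEntries w) ^ 2 =
      2 * (1 - (u ⬝ᵥ w) ^ 2 / ((u ⬝ᵥ u) * (w ⬝ᵥ w))) := by
  have hu' := (dotProduct_self_pos hu).ne'
  have hw' := (dotProduct_self_pos hw).ne'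
  have key (a b : Fin k → ℝ) :
      ∑ i, ∑ j, (a i * a j) * (b i * b j) = (a ⬝ᵥ b) ^ 2 := by
    rw [sq, dotProduct, Finset.sum_mul_sum]
    exact Finset.sum_congr rfl fun i _ => Finset.sum_congr rfl fun j _ => by ring
  have expand (s t : ℝ) : ∑ i, ∑ j, (u i * u j / s - w i * w j / t) ^ 2 =
      (u ⬝ᵥ u) ^ 2 / s ^ 2 - 2 * ((u ⬝ᵥ w) ^ 2 / (s * t)) + (w ⬝ᵥ w) ^ 2 / t ^ 2 := by
    rw [← key, ← key, ← key]
    simp only [Finset.sum_div, Finset.mul_sum, ← Finset.sum_sub_distrib, ← Finset.sum_add_distrib]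
    exact Finset.sum_congr rfl fun i _ => Finset.sum_congr rfl fun j _ => by
      simp only [div_eq_mul_inv, mul_inv]; ring
  rw [EuclideanSpace.dist_eq, Real.sq_sqrt (Finset.sum_nonneg fun _ _ => sq_nonneg _)]
  simp only [projectionEntries, Real.dist_eq, sq_abs, Fintype.sum_prod_type]
  rw [expand]
  field_simp
  ring

/-- The embedding of projective space in the space of matrices. -/
noncomputable def veronese (m : ℕ) : RP m → EuclideanSpace ℝ (Fin (m + 1) × Fin (m + 1)) :=
  Projectivization.lift (fun v => projectionEntries v.1) (by
    intro v w t h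
    rw [← dist_eq_zero, ← sq_eq_zero_iff, dist_projectionEntries_sq v.2 w.2]
    have ht : t ≠ 0 := by
      rintro rfl
      exact v.2 (by rw [h, zero_smul])
    have := (dotProduct_self_pos w.2).ne'
    rw [h]
    simp only [smul_dotProduct, dotProduct_smul, smul_eq_mul]
    field_simp
    ring)

theorem dist_veronese_sq {m : ℕ} {u w : Fin (m + 1) → ℝ} (hu : u ≠ 0) (hw : w ≠ 0) :
    dist (veronese m (Projectivization.mk ℝ u hu)) (veronese m (Projectivization.mk ℝ w hw)) ^ 2 =
      2 * (1 - (u ⬝ᵥ w) ^ 2 / ((u ⬝ᵥ u) * (w ⬝ᵥ w))) :=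
  dist_projectionEntries_sq hu hw

theorem continuous_veronese (m : ℕ) : Continuous (veronese m) := by
  refine continuous_coinduced_dom.2 ?_
  refine (PiLp.continuous_toLp 2 _).comp (continuous_pi fun ij => ?_)
  have hc (i : Fin (m + 1)) : Continuous fun v : Punctured (m + 1) => v.1 i :=
    (continuous_apply i).comp continuous_subtype_val
  exact ((hc _).mul (hc _)).div (continuous_finsetSum _ fun i _ => (hc i).mul (hc i))
    fun v => (dotProduct_self_pos v.2).ne'

theorem dotProduct_sq_le {k : ℕ} (u w : Fin k → ℝ) :
    (u ⬝ᵥ w) ^ 2 ≤ (u ⬝ᵥ u) * (w ⬝ᵥ w) := by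
  have := Finset.sum_mul_sq_le_sq_mul_sq Finset.univ u w
  simpa only [dotProduct, ← sq] using this

theorem injective_veronese (m : ℕ) : Function.Injective (veronese m) := by
  intro x y h
  induction x using Projectivization.ind with | h u hu => ?_
  induction y using Projectivization.ind with | h w hw => ?_
  rw [← dist_eq_zero, ← sq_eq_zero_iff, dist_veronese_sq hu hw] at h
  have hu' := dotProduct_self_pos hu
  have hw' := dotProduct_self_pos hw
  have h1 : (u ⬝ᵥ w) ^ 2 = (u ⬝ᵥ u) * (w ⬝ᵥ w) := by
    have : (u ⬝ᵥ w) ^ 2 / ((u ⬝ᵥ u) * (w ⬝ᵥ w)) = 1 := by linarith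
    rwa [div_eq_one_iff_eq (mul_pos hu' hw').ne'] at this
  rw [Projectivization.mk_eq_mk_iff']
  refine ⟨(u ⬝ᵥ w) / (w ⬝ᵥ w), ?_⟩
  rw [← sub_eq_zero, ← dotProduct_self_eq_zero]
  simp only [sub_dotProduct, dotProduct_sub, smul_dotProduct, dotProduct_smul, smul_eq_mul,
    dotProduct_comm w u]
  field_simp
  rw [h1]
  ring

/-- Compactness makes the injective map `veronese` an embedding, and makes the compact-open topology
on loops that of the uniform metric. -/
instance instCompactSpaceRP (m : ℕ) : CompactSpace (RP m) := by
  let S := Metric.sphere (0 : EuclideanSpace ℝ (Fin (m + 1))) 1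
  have hS (v : S) : WithLp.ofLp v.1 ≠ 0 := by
    intro h
    have : v.1 = 0 := by ext i; exact congrFun h i
    have := v.2
    simp_all [S]
  have hc : Continuous fun v : S =>
      (Projectivization.mk' ℝ ⟨WithLp.ofLp v.1, hS v⟩ : RP m) :=
    (isOpenQuotientMap_mk' m).continuous.comp
      (Continuous.subtype_mk ((PiLp.continuous_ofLp 2 _).comp continuous_subtype_val) _)
  have hs : Function.Surjective fun v : S =>
      (Projectivization.mk' ℝ ⟨WithLp.ofLp v.1, hS v⟩ : RP m) := by
    intro x
    induction x using Projectivization.ind with | h u hu => ?_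
    have hu' : ‖WithLp.toLp 2 u‖ ≠ 0 := by
      rw [norm_ne_zero_iff]
      exact fun h => hu (congrArg WithLp.ofLp h)
    refine ⟨⟨‖WithLp.toLp 2 u‖⁻¹ • WithLp.toLp 2 u, ?_⟩, ?_⟩
    · simp [S, norm_smul, inv_mul_cancel₀ hu']
    · refine (mk'_eq_mk'_iff _ ⟨u, hu⟩).2 ⟨‖WithLp.toLp 2 u‖⁻¹, rfl⟩
  exact hs.compactSpace hc

theorem isEmbedding_veronese (m : ℕ) : IsEmbedding (veronese m) :=
  ((continuous_veronese m).isClosedEmbedding (injective_veronese m)).isEmbedding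

/-- The chordal metric of projective space. -/
noncomputable instance instMetricSpaceRP (m : ℕ) : MetricSpace (RP m) :=
  (isEmbedding_veronese m).comapMetricSpace (veronese m)

theorem dist_mk_sq {m : ℕ} {u w : Fin (m + 1) → ℝ} (hu : u ≠ 0) (hw : w ≠ 0) :
    dist (Projectivization.mk ℝ u hu : RP m) (Projectivization.mk ℝ w hw) ^ 2 =
      2 * (1 - (u ⬝ᵥ w) ^ 2 / ((u ⬝ᵥ u) * (w ⬝ᵥ w))) :=
  dist_veronese_sq hu hw

/-! ### Homogenized and normalized tuples of polynomials -/

/-- The value of the degree `n` homogenization of a polynomial. -/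
noncomputable def homEval (n : ℕ) (p : ℝ[X]) (v : Fin 2 → ℝ) : ℝ :=
  ∑ k ∈ Finset.range (n + 1), p.coeff k * v 0 ^ k * v 1 ^ (n - k)

theorem homEval_of_ne_zero {n : ℕ} {p : ℝ[X]} (hp : p.natDegree ≤ n) {v : Fin 2 → ℝ}
    (hv : v 1 ≠ 0) : homEval n p v = v 1 ^ n * p.eval (v 0 / v 1) := by
  rw [homEval, eval_eq_sum_range' (Nat.lt_succ_of_le hp), Finset.mul_sum]
  refine Finset.sum_congr rfl fun k hk => ?_
  have hk' : k ≤ n := Nat.lt_succ_iff.1 (Finset.mem_range.1 hk)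
  rw [div_pow, ← Nat.sub_add_cancel hk', pow_add]
  simp only [Nat.add_sub_cancel]
  field_simp

theorem homEval_of_eq_zero (n : ℕ) (p : ℝ[X]) {v : Fin 2 → ℝ} (hv : v 1 = 0) :
    homEval n p v = p.coeff n * v 0 ^ n := by
  rw [homEval, Finset.sum_range_succ, Finset.sum_eq_zero]
  · simp
  · intro k hk
    have := Finset.mem_range.1 hk
    rw [hv, zero_pow (by omega), mul_zero]

theorem homEval_smul (n : ℕ) (p : ℝ[X]) (c : ℝ) (v : Fin 2 → ℝ) :
    homEval n p (c • v) = c ^ n * homEval n p v := by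
  rw [homEval, homEval, Finset.mul_sum]
  refine Finset.sum_congr rfl fun k hk => ?_
  have hk' : k ≤ n := Nat.lt_succ_iff.1 (Finset.mem_range.1 hk)
  have h : c ^ n = c ^ k * c ^ (n - k) := by rw [← pow_add, Nat.add_sub_cancel' hk']
  simp only [Pi.smul_apply, smul_eq_mul, mul_pow, h]
  ring

/-- The Euclidean length of a vector in the plane. -/
noncomputable def planeNorm (v : Fin 2 → ℝ) : ℝ := √(v 0 ^ 2 + v 1 ^ 2)

theorem planeNorm_pos (v : Punctured 2) : 0 < planeNorm v.1 := by
  refine Real.sqrt_pos.2 (lt_of_le_of_ne (by positivity) fun h => v.2 ?_)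
  have h0 : v.1 0 = 0 := by nlinarith [sq_nonneg (v.1 0), sq_nonneg (v.1 1)]
  have h1 : v.1 1 = 0 := by nlinarith [sq_nonneg (v.1 0), sq_nonneg (v.1 1)]
  ext i
  fin_cases i
  · exact h0
  · exact h1

theorem planeNorm_sq (v : Fin 2 → ℝ) : planeNorm v ^ 2 = v 0 ^ 2 + v 1 ^ 2 :=
  Real.sq_sqrt (by positivity)

theorem continuous_punctured_apply {k : ℕ} (i : Fin k) :
    Continuous fun v : Punctured k => v.1 i :=
  (continuous_apply i).comp continuous_subtype_val

theorem continuous_planeNorm : Continuous fun v : Punctured 2 => planeNorm v.1 :=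
  Real.continuous_sqrt.comp
    (((continuous_punctured_apply 0).pow 2).add ((continuous_punctured_apply 1).pow 2))

variable {m : ℕ}

/-- A tuple of polynomials of degree `n` as a function on the punctured plane that is homogeneous
of degree zero up to sign. -/
noncomputable def normForm (n : ℕ) (p : Fin (m + 1) → ℝ[X]) :
    C(Punctured 2, Fin (m + 1) → ℝ) where
  toFun v i := homEval n (p i) v.1 / planeNorm v.1 ^ n
  continuous_toFun := continuous_pi fun _ =>
    (continuous_finsetSum _ fun k _ => ((continuous_const.mul
      ((continuous_punctured_apply 0).pow k)).mul ((continuous_punctured_apply 1).pow _))).div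
      (continuous_planeNorm.pow n) fun v => (pow_pos (planeNorm_pos v) n).ne'

theorem normForm_apply (n : ℕ) (p : Fin (m + 1) → ℝ[X]) (v : Punctured 2) (i : Fin (m + 1)) :
    normForm n p v i = homEval n (p i) v.1 / planeNorm v.1 ^ n := rfl

theorem smul_normForm_add (n : ℕ) (p q : Fin (m + 1) → ℝ[X]) (a b : ℝ) :
    a • normForm n p + b • normForm n q = normForm n (a • p + b • q) := by
  ext v i
  simp only [ContinuousMap.add_apply, ContinuousMap.smul_apply, Pi.add_apply, Pi.smul_apply,
    normForm_apply, homEval, coeff_add, coeff_smul, smul_eq_mul, Finset.sum_div, Finset.mul_sum,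
    ← Finset.sum_add_distrib]
  exact Finset.sum_congr rfl fun k _ => by ring

/-- The polynomials of the tuple are monic of degree `n`. -/
def IsMonicTuple (n : ℕ) (p : Fin (m + 1) → ℝ[X]) : Prop :=
  ∀ i, (p i).Monic ∧ (p i).natDegree = n

theorem IsMonicTuple.coeff_eq_one {n : ℕ} {p : Fin (m + 1) → ℝ[X]} (hp : IsMonicTuple n p)
    (i : Fin (m + 1)) : (p i).coeff n = 1 := by
  rw [← (hp i).2]; exact (hp i).1

theorem isMonicTuple_of_coeff {n : ℕ} {p : Fin (m + 1) → ℝ[X]}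
    (h : ∀ i, (p i).natDegree ≤ n ∧ (p i).coeff n = 1) : IsMonicTuple n p := fun i =>
  ⟨monic_of_natDegree_le_of_coeff_eq_one n (h i).1 (h i).2,
    le_antisymm (h i).1 (le_natDegree_of_ne_zero (by rw [(h i).2]; exact one_ne_zero))⟩

theorem IsMonicTuple.convexCombo {n : ℕ} {p q : Fin (m + 1) → ℝ[X]} (hp : IsMonicTuple n p)
    (hq : IsMonicTuple n q) {a b : ℝ} (hab : a + b = 1) : IsMonicTuple n (a • p + b • q) := by
  refine isMonicTuple_of_coeff fun i => ⟨?_, ?_⟩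
  · exact natDegree_add_le_of_degree_le ((natDegree_smul_le _ _).trans (hp i).2.le)
      ((natDegree_smul_le _ _).trans (hq i).2.le)
  · simp [hp.coeff_eq_one, hq.coeff_eq_one, hab]

theorem natDegree_X_sq_add_one : (X ^ 2 + 1 : ℝ[X]).natDegree = 2 := by
  compute_degree!

theorem monic_X_sq_add_one : (X ^ 2 + 1 : ℝ[X]).Monic :=
  monic_X_pow_add_C (1 : ℝ) two_ne_zero

theorem IsMonicTuple.mul_X_sq_add_one {n : ℕ} {p : Fin (m + 1) → ℝ[X]} (hp : IsMonicTuple n p) :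
    IsMonicTuple (n + 2) fun i => p i * (X ^ 2 + 1) := fun i =>
  ⟨(hp i).1.mul monic_X_sq_add_one, by
    rw [(hp i).1.natDegree_mul monic_X_sq_add_one, (hp i).2, natDegree_X_sq_add_one]⟩

/-- The homogenization of `x ^ 2 + 1` is `planeNorm ^ 2`, which the normalization cancels. -/
theorem normForm_mul_X_sq_add_one {n : ℕ} {p : Fin (m + 1) → ℝ[X]} (hp : IsMonicTuple n p) :
    normForm (n + 2) (fun i => p i * (X ^ 2 + 1)) = normForm n p := by
  ext v i
  have hN := (planeNorm_pos v).ne'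
  rw [normForm_apply, normForm_apply, div_eq_div_iff (pow_ne_zero _ hN) (pow_ne_zero _ hN),
    pow_add, planeNorm_sq]
  by_cases h : v.1 1 = 0
  · rw [homEval_of_eq_zero _ _ h, homEval_of_eq_zero _ _ h, hp.coeff_eq_one,
      hp.mul_X_sq_add_one.coeff_eq_one, h]
    ring
  · rw [homEval_of_ne_zero (hp i).2.le h, homEval_of_ne_zero (hp.mul_X_sq_add_one i).2.le h]
    simp only [eval_mul, eval_add, eval_pow, eval_X, eval_one]
    field_simp
    ring

/-- The vector `(1, 0)`. -/
def infinityVector : Punctured 2 := ⟨![1, 0], fun h => one_ne_zero (congrFun h 0)⟩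

/-- The vector `(x, 1)`. -/
def affineVector (x : ℝ) : Punctured 2 := ⟨![x, 1], fun h => one_ne_zero (congrFun h 1)⟩

theorem normForm_affineVector {n : ℕ} {p : Fin (m + 1) → ℝ[X]} (hp : IsMonicTuple n p) (x : ℝ) :
    normForm n p (affineVector x) = (√(x ^ 2 + 1) ^ n)⁻¹ • fun i => (p i).eval x := by
  ext i
  rw [normForm_apply, homEval_of_ne_zero (hp i).2.le (by simp [affineVector])]
  simp [affineVector, planeNorm, div_eq_inv_mul]

theorem normForm_infinityVector {n : ℕ} {p : Fin (m + 1) → ℝ[X]} (hp : IsMonicTuple n p) :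
    normForm n p infinityVector = fun _ => 1 := by
  ext i
  rw [normForm_apply, homEval_of_eq_zero _ _ (by simp [infinityVector]), hp.coeff_eq_one]
  simp [infinityVector, planeNorm]

/-! ### From functions on the punctured plane to loops -/

/-- Nowhere vanishing functions on the punctured plane that descend to based maps of
projective spaces. -/
def IsLift (Φ : C(Punctured 2, Fin (m + 1) → ℝ)) : Prop :=
  (∀ v, Φ v ≠ 0) ∧ (∀ v w : Punctured 2, (∃ a : ℝ, a • w.1 = v.1) → ∃ b : ℝ, b • Φ w = Φ v) ∧
    ∃ b : ℝ, b • (fun _ => 1) = Φ infinityVector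

/-- The map of projective spaces of a function on the punctured plane. -/
noncomputable def toMap (Φ : {Φ : C(Punctured 2, Fin (m + 1) → ℝ) // IsLift Φ}) :
    C(RP 1, RP m) where
  toFun := Projectivization.lift (fun v => Projectivization.mk ℝ (Φ.1 v) (Φ.2.1 v)) (by
    intro v w t h
    rw [Projectivization.mk_eq_mk_iff']
    exact Φ.2.2.1 v w ⟨t, h.symm⟩)
  continuous_toFun := by
    refine (isOpenQuotientMap_mk' 1).continuous_comp_iff.1 ?_
    exact (isOpenQuotientMap_mk' m).continuous.comp (Φ.1.continuous.subtype_mk Φ.2.1)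

/-- The loop of a function on the punctured plane. -/
noncomputable def toLoop (Φ : {Φ : C(Punctured 2, Fin (m + 1) → ℝ) // IsLift Φ}) :
    LoopSpace m :=
  ⟨toMap Φ, (Projectivization.mk_eq_mk_iff' _ _ _ _ _).2 Φ.2.2.2⟩

instance : LocallyCompactSpace (Punctured 2) :=
  (isOpen_ne (x := (0 : Fin 2 → ℝ))).locallyCompactSpace

/-- By currying it suffices to have joint continuity. The product of the identity with the open
quotient map is again a quotient map, and evaluation is continuous because the punctured plane is
locally compact. -/
theorem continuous_toLoop :
    Continuous (toLoop : {Φ : C(Punctured 2, Fin (m + 1) → ℝ) // IsLift Φ} → LoopSpace m) := by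
  refine Continuous.subtype_mk (ContinuousMap.continuous_of_continuous_uncurry _ ?_) _
  refine (IsOpenQuotientMap.id.prodMap (isOpenQuotientMap_mk' 1)).continuous_comp_iff.1 ?_
  refine (isOpenQuotientMap_mk' m).continuous.comp (f := fun z :
    {Φ : C(Punctured 2, Fin (m + 1) → ℝ) // IsLift Φ} × Punctured 2 =>
      (⟨z.1.1 z.2, z.1.2.1 z.2⟩ : Punctured (m + 1))) (Continuous.subtype_mk ?_ _)
  exact (continuous_subtype_val.comp continuous_fst).eval continuous_snd

theorem eq_infinityPoint_or_affinePoint (z : RP 1) :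
    z = infinityPoint ∨ ∃ x, z = affinePoint x := by
  induction z using Projectivization.ind with | h v hv => ?_
  by_cases h : v 1 = 0
  · left
    refine (Projectivization.mk_eq_mk_iff' _ _ _ _ _).2 ⟨v 0, ?_⟩
    ext i; fin_cases i <;> simp [h]
  · right
    refine ⟨v 0 / v 1, (Projectivization.mk_eq_mk_iff' _ _ _ _ _).2 ⟨v 1, ?_⟩⟩
    ext i; fin_cases i <;> simp [mul_div_cancel₀ _ h]

theorem loop_ext {f g : LoopSpace m} (h : ∀ x, f.1 (affinePoint x) = g.1 (affinePoint x)) :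
    f = g := by
  refine Subtype.ext (ContinuousMap.ext fun z => ?_)
  obtain rfl | ⟨x, rfl⟩ := eq_infinityPoint_or_affinePoint z
  · rw [f.2, g.2]
  · exact h x

theorem isLift_normForm {n : ℕ} {p : Fin (m + 1) → ℝ[X]} (hp : IsMonicTuple n p)
    (h0 : ∀ v, normForm n p v ≠ 0) : IsLift (normForm n p) := by
  refine ⟨h0, ?_, 1, by rw [normForm_infinityVector hp, one_smul]⟩
  rintro v w ⟨a, h⟩
  refine ⟨a ^ n * planeNorm w.1 ^ n / planeNorm v.1 ^ n, ?_⟩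
  ext i
  have hN := (planeNorm_pos w).ne'
  rw [Pi.smul_apply, normForm_apply, normForm_apply, ← h, homEval_smul, smul_eq_mul]
  field_simp

theorem normForm_ne_zero {n : ℕ} {p : Fin (m + 1) → ℝ[X]} (hp : IsMonicTuple n p)
    (h0 : ∀ x : ℝ, ∃ i, (p i).eval x ≠ 0) (v : Punctured 2) : normForm n p v ≠ 0 := by
  have hN := (planeNorm_pos v).ne'
  by_cases h : v.1 1 = 0
  · intro h'
    have := congrFun h' 0
    rw [normForm_apply, homEval_of_eq_zero _ _ h, hp.coeff_eq_one] at this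
    have h1 : v.1 0 = 0 := by
      simp only [one_mul, Pi.zero_apply, div_eq_zero_iff, pow_eq_zero_iff', hN] at this
      tauto
    refine v.2 (funext fun i => ?_)
    fin_cases i
    · exact h1
    · exact h
  · obtain ⟨i, hi⟩ := h0 (v.1 0 / v.1 1)
    intro h'
    have := congrFun h' i
    rw [normForm_apply, homEval_of_ne_zero (hp i).2.le h] at this
    simp_all

/-- The loop of a tuple of monic polynomials without common real root. -/
noncomputable def polyLoop (n : ℕ) (p : Fin (m + 1) → ℝ[X]) (hp : IsMonicTuple n p)
    (h0 : ∀ v, normForm n p v ≠ 0) : LoopSpace m :=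
  toLoop ⟨normForm n p, isLift_normForm hp h0⟩

theorem polyLoop_mk' {n : ℕ} {p : Fin (m + 1) → ℝ[X]} (hp : IsMonicTuple n p)
    (h0 : ∀ v, normForm n p v ≠ 0) (v : Punctured 2) :
    (polyLoop n p hp h0).1 (Projectivization.mk' ℝ v) =
      Projectivization.mk ℝ (normForm n p v) (h0 v) := rfl

theorem eval_ne_zero_of_normForm {n : ℕ} {p : Fin (m + 1) → ℝ[X]} (hp : IsMonicTuple n p)
    (h0 : ∀ v, normForm n p v ≠ 0) (x : ℝ) : (fun i => (p i).eval x) ≠ 0 := by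
  intro h
  apply h0 (affineVector x)
  rw [normForm_affineVector hp, h, smul_zero]

theorem polyLoop_affinePoint {n : ℕ} {p : Fin (m + 1) → ℝ[X]} (hp : IsMonicTuple n p)
    (h0 : ∀ v, normForm n p v ≠ 0) (x : ℝ) :
    (polyLoop n p hp h0).1 (affinePoint x) =
      Projectivization.mk ℝ (fun i => (p i).eval x) (eval_ne_zero_of_normForm hp h0 x) :=
  (Projectivization.mk_eq_mk_iff' _ _ _ _ _).2 ⟨_, (normForm_affineVector hp x).symm⟩

theorem exists_polyLoop_of_mem_RRat {n : ℕ} {f : LoopSpace m} (hf : f ∈ RRat n m) :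
    ∃ p, ∃ hp : IsMonicTuple n p, ∃ h0, f = polyLoop n p hp h0 := by
  obtain ⟨p, hp, -, h⟩ := hf
  have hp' : IsMonicTuple n p := hp
  refine ⟨p, hp', normForm_ne_zero hp' fun x => ?_, ?_⟩
  · obtain ⟨hx, -⟩ := h x
    exact Function.ne_iff.1 hx
  · refine loop_ext fun x => ?_
    rw [polyLoop_affinePoint]
    exact (h x).2

theorem polyLoop_mem_RRat {n : ℕ} {p : Fin (m + 1) → ℝ[X]} (hp : IsMonicTuple n p)
    (h0 : ∀ v, normForm n p v ≠ 0) (hz : ∀ z : ℂ, ∃ i, aeval z (p i) ≠ 0) :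
    polyLoop n p hp h0 ∈ RRat n m :=
  ⟨p, hp, hz, fun x => ⟨_, polyLoop_affinePoint hp h0 x⟩⟩

/-! ### Tuples with common complex roots, and stabilization of the degree -/

theorem exists_eval_ne_zero_of_aeval {p : Fin (m + 1) → ℝ[X]}
    (hz : ∀ z : ℂ, ∃ i, aeval z (p i) ≠ 0) (x : ℝ) : ∃ i, (p i).eval x ≠ 0 := by
  obtain ⟨i, hi⟩ := hz x
  refine ⟨i, fun h => hi ?_⟩
  have : aeval (algebraMap ℝ ℂ x) (p i) = algebraMap ℝ ℂ ((p i).eval x) :=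
    aeval_algebraMap_apply_eq_algebraMap_eval x (p i)
  rw [h, map_zero] at this
  exact this

/-- Common non-real roots are harmless in the closure: adding a small constant to the last
polynomial destroys them for all but finitely many values of the constant. -/
theorem polyLoop_mem_rat (hm : 1 ≤ m) {n : ℕ} {p : Fin (m + 1) → ℝ[X]} (hp : IsMonicTuple n p)
    (h0 : ∀ v, normForm n p v ≠ 0) : polyLoop n p hp h0 ∈ rat n m := by
  -- In degree `0` the perturbation would not be monic, but there every polynomial is `1`.
  rcases Nat.eq_zero_or_pos n with rfl | hn
  · refine subset_closure (polyLoop_mem_RRat hp h0 fun z => ⟨0, ?_⟩)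
    rw [((hp 0).1.natDegree_eq_zero).1 (hp 0).2]
    simp
  have hl : Fin.last m ≠ 0 := by
    intro h
    have := congrArg Fin.val h
    simp at this
    omega
  let q : Fin (m + 1) → ℝ[X] := Pi.single (Fin.last m) 1
  have hq (i) : (q i).natDegree = 0 := by
    by_cases hi : i = Fin.last m
    · subst hi; simp [q]
    · simp [q, hi]
  have hP (ε : ℝ) : IsMonicTuple n ((1 : ℝ) • p + ε • q) := by
    refine isMonicTuple_of_coeff fun i => ⟨?_, ?_⟩
    · exact natDegree_add_le_of_degree_le ((natDegree_smul_le _ _).trans (hp i).2.le)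
        ((natDegree_smul_le _ _).trans ((hq i).trans_le n.zero_le))
    · have : (q i).coeff n = 0 := coeff_eq_zero_of_natDegree_lt (by rw [hq]; exact hn)
      simp [hp.coeff_eq_one, this]
  let Good : Set ℝ := {ε | ∀ v, normForm n ((1 : ℝ) • p + ε • q) v ≠ 0}
  let F : Good → LoopSpace m := fun ε => polyLoop n _ (hP ε) ε.2
  have hF : Continuous F := by
    refine continuous_toLoop.comp (Continuous.subtype_mk ?_ _)
    simp only [← smul_normForm_add]
    exact continuous_const.add (continuous_subtype_val.smul continuous_const)
  let B : Set ℝ := {ε | ¬ ∀ z : ℂ, ∃ i, aeval z (((1 : ℝ) • p + ε • q) i) ≠ 0}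
  have hB : B.Finite := by
    -- A common root `z` of the perturbed tuple is a root of `p 0`, which is unperturbed because `0
    -- ≠ Fin.last m`. The last entry then forces `ε` to be minus the value of the last polynomial at
    -- `z`.
    refine (((p 0).aroots ℂ).toFinset.finite_toSet.image
      fun z => -(aeval z (p (Fin.last m))).re).subset ?_
    intro ε hε
    simp only [B, mem_ofPred_eq, not_forall, not_exists, not_not] at hε
    obtain ⟨z, hz⟩ := hε
    refine ⟨z, ?_, ?_⟩
    · have := hz 0
      simp only [Pi.add_apply, Pi.smul_apply, q, Pi.single_eq_of_ne hl.symm, smul_zero, add_zero,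
        one_smul] at this
      simpa [mem_aroots, (hp 0).1.ne_zero] using this
    · have := congrArg Complex.re (hz (Fin.last m))
      simp only [Pi.add_apply, Pi.smul_apply, q, Pi.single_eq_same, one_smul, map_add,
        map_smul, map_one, Complex.add_re, Complex.smul_re, Complex.one_re, smul_eq_mul, mul_one,
        Complex.zero_re] at this
      linarith
  have hsub : Bᶜ ⊆ Good := fun ε hε =>
    normForm_ne_zero (hP ε) (exists_eval_ne_zero_of_aeval (not_not.1 hε))
  have hzero : (0 : ℝ) ∈ Good := by
    simp only [Good, mem_ofPred_eq, zero_smul, add_zero, one_smul]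
    exact h0
  have hcl : (⟨0, hzero⟩ : Good) ∈ closure ((↑) ⁻¹' Bᶜ : Set Good) := by
    rw [closure_subtype, Subtype.image_preimage_coe, inter_eq_right.2 hsub]
    exact (hB.countable.dense_compl ℝ) 0
  have e : (1 : ℝ) • p + (0 : ℝ) • q = p := by rw [one_smul, zero_smul, add_zero]
  have eF : polyLoop n p hp h0 = F ⟨0, hzero⟩ := by simp only [F, e]
  rw [eF]
  exact map_mem_closure hF hcl fun ε hε => polyLoop_mem_RRat (hP ε) ε.2 (not_not.1 hε)

/-- The factor `x ^ 2 + 1` adds the common roots `i` and `-i`, so the enlarged tuple itself only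
witnesses membership in the closure. -/
theorem RRat_subset_rat_add_two (hm : 1 ≤ m) (n : ℕ) : RRat n m ⊆ rat (n + 2) m := by
  intro f hf
  obtain ⟨p, hp, h0, rfl⟩ := exists_polyLoop_of_mem_RRat hf
  have h := normForm_mul_X_sq_add_one hp
  have h0' : ∀ v, normForm (n + 2) (fun i => p i * (X ^ 2 + 1)) v ≠ 0 := by rwa [h]
  convert polyLoop_mem_rat hm hp.mul_X_sq_add_one h0' using 1
  simp only [polyLoop, h]

theorem rat_subset_rat_add_two_mul (hm : 1 ≤ m) (n k : ℕ) : rat n m ⊆ rat (n + 2 * k) m := by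
  induction k with
  | zero => exact subset_rfl
  | succ k ih =>
    exact ih.trans (closure_minimal (RRat_subset_rat_add_two hm _) isClosed_closure)

theorem normForm_mul_X_sq_add_one_pow {n : ℕ} {p : Fin (m + 1) → ℝ[X]} (hp : IsMonicTuple n p)
    (k : ℕ) : ∃ q : Fin (m + 1) → ℝ[X], IsMonicTuple (n + 2 * k) q ∧
      normForm (n + 2 * k) q = normForm n p := by
  induction k with
  | zero => exact ⟨p, hp, rfl⟩
  | succ k ih =>
    obtain ⟨q, hq, h⟩ := ih
    exact ⟨_, hq.mul_X_sq_add_one, (normForm_mul_X_sq_add_one hq).trans h⟩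

/-! ### Convexity of cones around a line -/

theorem dotProduct_ne_zero_of_dist_le_one {u w : Fin (m + 1) → ℝ} (hu : u ≠ 0) (hw : w ≠ 0)
    (h : dist (Projectivization.mk ℝ u hu : RP m) (Projectivization.mk ℝ w hw) ≤ 1) :
    u ⬝ᵥ w ≠ 0 := by
  intro h0
  have h2 := dist_mk_sq hu hw
  rw [h0] at h2
  have h3 := dist_nonneg (x := (Projectivization.mk ℝ u hu : RP m))
    (y := Projectivization.mk ℝ w hw)
  norm_num at h2
  nlinarith

theorem dist_mk_lt_iff {u w : Fin (m + 1) → ℝ} (hu : u ≠ 0) (hw : w ≠ 0) {r : ℝ} (hr : 0 < r) :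
    dist (Projectivization.mk ℝ u hu : RP m) (Projectivization.mk ℝ w hw) < r ↔
      (1 - r ^ 2 / 2) * ((u ⬝ᵥ u) * (w ⬝ᵥ w)) < (u ⬝ᵥ w) ^ 2 := by
  have hp := mul_pos (dotProduct_self_pos hu) (dotProduct_self_pos hw)
  rw [← sq_lt_sq₀ dist_nonneg hr.le, dist_mk_sq hu hw, ← lt_div_iff₀ hp]
  constructor <;> intro h <;> linarith

/-- The vectors whose line is `r`-close to that of `u` form a double cone of half-angle at most 45
degrees. A positive dot product puts `w₁` and `w₂` in the same half, which is convex. -/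
theorem dist_mk_convexCombo_lt {u w₁ w₂ : Fin (m + 1) → ℝ} (hu : u ≠ 0) (h₁ : w₁ ≠ 0)
    (h₂ : w₂ ≠ 0) (hpos : 0 < w₁ ⬝ᵥ w₂) {r : ℝ} (hr : r ≤ 1)
    (hd₁ : dist (Projectivization.mk ℝ w₁ h₁ : RP m) (Projectivization.mk ℝ u hu) < r)
    (hd₂ : dist (Projectivization.mk ℝ w₂ h₂ : RP m) (Projectivization.mk ℝ u hu) < r)
    {a b : ℝ} (ha : 0 ≤ a) (hb : 0 ≤ b) (hab : a + b = 1) :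
    ∃ h : a • w₁ + b • w₂ ≠ 0,
      dist (Projectivization.mk ℝ _ h : RP m) (Projectivization.mk ℝ u hu) < r := by
  have hr0 : 0 < r := dist_nonneg.trans_lt hd₁
  rw [dist_mk_lt_iff _ _ hr0] at hd₁ hd₂
  set κ := 1 - r ^ 2 / 2 with hκ
  have hκ' : 1 / 2 ≤ κ := by nlinarith
  have hU := dotProduct_self_pos hu
  have hW₁ := dotProduct_self_pos h₁
  have hW₂ := dotProduct_self_pos h₂
  have hcs := dotProduct_sq_le w₁ w₂
  -- Cauchy-Schwarz for the components of `w₁` and `w₂` orthogonal to `u`, scaled by `u ⬝ᵥ u`.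
  have hgram : ((w₁ ⬝ᵥ w₂) * (u ⬝ᵥ u) - (w₁ ⬝ᵥ u) * (w₂ ⬝ᵥ u)) ^ 2 ≤
      ((w₁ ⬝ᵥ w₁) * (u ⬝ᵥ u) - (w₁ ⬝ᵥ u) ^ 2) * ((w₂ ⬝ᵥ w₂) * (u ⬝ᵥ u) - (w₂ ⬝ᵥ u) ^ 2) := by
    have := dotProduct_sq_le ((u ⬝ᵥ u) • w₁ - (w₁ ⬝ᵥ u) • u) ((u ⬝ᵥ u) • w₂ - (w₂ ⬝ᵥ u) • u)
    simp only [sub_dotProduct, dotProduct_sub, smul_dotProduct, dotProduct_smul, smul_eq_mul,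
      dotProduct_comm u w₁, dotProduct_comm u w₂] at this
    refine le_of_mul_le_mul_left ?_ (pow_pos hU 2)
    nlinarith [this]
  set A := w₁ ⬝ᵥ u
  set B := w₂ ⬝ᵥ u
  set U := u ⬝ᵥ u
  set W₁ := w₁ ⬝ᵥ w₁
  set W₂ := w₂ ⬝ᵥ w₂
  set D := w₁ ⬝ᵥ w₂
  have hA : W₁ * U - A ^ 2 < A ^ 2 := by nlinarith [mul_pos hW₁ hU]
  have hB : W₂ * U - B ^ 2 < B ^ 2 := by nlinarith [mul_pos hW₂ hU]
  have hA0 : 0 < A ^ 2 := by nlinarith [mul_pos hW₁ hU]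
  have hB0 : 0 < B ^ 2 := by nlinarith [mul_pos hW₂ hU]
  have hDU : 0 < D * U := mul_pos hpos hU
  -- If `A * B ≤ 0`, then `(D * U - A * B) ^ 2` exceeds `A ^ 2 * B ^ 2`, whereas `hgram` bounds it
  -- by that product because both angles are under 45 degrees.
  have hAB : 0 < A * B := by
    by_contra hn
    push Not at hn
    have hA1 : 0 ≤ W₁ * U - A ^ 2 := by
      have := dotProduct_sq_le w₁ u
      linarith
    have h1 : (D * U - A * B) ^ 2 ≤ A ^ 2 * B ^ 2 :=
      hgram.trans ((mul_le_mul_of_nonneg_left hB.le hA1).trans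
        (mul_le_mul_of_nonneg_right hA.le hB0.le))
    nlinarith
  have hABκ : κ * (D * U) < A * B := by
    refine lt_of_pow_lt_pow_left₀ 2 hAB.le ?_
    calc (κ * (D * U)) ^ 2 = κ ^ 2 * U ^ 2 * D ^ 2 := by ring
      _ ≤ κ ^ 2 * U ^ 2 * (W₁ * W₂) := mul_le_mul_of_nonneg_left hcs (by positivity)
      _ = (κ * (W₁ * U)) * (κ * (W₂ * U)) := by ring
      _ < A ^ 2 * B ^ 2 := mul_lt_mul'' hd₁ hd₂ (by positivity) (by positivity)
      _ = (A * B) ^ 2 := by ring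
  have hself : (a • w₁ + b • w₂) ⬝ᵥ (a • w₁ + b • w₂) =
      a ^ 2 * W₁ + 2 * (a * b) * D + b ^ 2 * W₂ := by
    simp only [add_dotProduct, dotProduct_add, smul_dotProduct, dotProduct_smul, smul_eq_mul,
      dotProduct_comm w₂ w₁]
    ring
  have hu' : (a • w₁ + b • w₂) ⬝ᵥ u = a * A + b * B := by
    simp only [add_dotProduct, smul_dotProduct, smul_eq_mul, A, B]
  have hab' : 0 ≤ a * b := mul_nonneg ha hb
  have hsq : 0 < a ^ 2 + b ^ 2 := by nlinarith [sq_nonneg (a - b)]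
  have hmain : κ * ((a ^ 2 * W₁ + 2 * (a * b) * D + b ^ 2 * W₂) * U) < (a * A + b * B) ^ 2 := by
    have e1 : a ^ 2 * (κ * (W₁ * U)) + b ^ 2 * (κ * (W₂ * U)) < a ^ 2 * A ^ 2 + b ^ 2 * B ^ 2 := by
      rcases ha.eq_or_lt with rfl | ha'
      · have : b = 1 := by linarith
        subst this
        nlinarith
      · have := mul_lt_mul_of_pos_left hd₁ (pow_pos ha' 2)
        have := mul_le_mul_of_nonneg_left hd₂.le (sq_nonneg b)
        linarith
    have e2 := mul_le_mul_of_nonneg_left hABκ.le hab'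
    nlinarith
  have h0 : a • w₁ + b • w₂ ≠ 0 := by
    intro h
    have h' := hself
    rw [h, zero_dotProduct] at h' hu'
    rw [← h', ← hu'] at hmain
    simp at hmain
  refine ⟨h0, (dist_mk_lt_iff _ _ hr0).2 ?_⟩
  rw [hself, hu']
  exact hmain

/-! ### Signs, parity of the degree, and convexity of the near forms -/

instance : PreconnectedSpace (Punctured 2) := by
  have h : IsPathConnected ({0}ᶜ : Set (Fin 2 → ℝ)) :=
    isPathConnected_compl_singleton_of_one_lt_rank (by
      rw [← Module.finrank_eq_rank, Module.finrank_fin_fun]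
      exact_mod_cast one_lt_two) 0
  exact Subtype.preconnectedSpace h.isConnected.isPreconnected

theorem continuous_dotProduct_apply (Φ Ψ : C(Punctured 2, Fin (m + 1) → ℝ)) :
    Continuous fun v => Φ v ⬝ᵥ Ψ v :=
  continuous_finsetSum _ fun i _ =>
    ((continuous_apply i).comp Φ.continuous).mul ((continuous_apply i).comp Ψ.continuous)

theorem dotProduct_normForm_infinityVector {n n' : ℕ} {p q : Fin (m + 1) → ℝ[X]}
    (hp : IsMonicTuple n p) (hq : IsMonicTuple n' q) :
    normForm n p infinityVector ⬝ᵥ normForm n' q infinityVector = m + 1 := by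
  rw [normForm_infinityVector hp, normForm_infinityVector hq]
  simp [dotProduct]

/-- The dot product is positive at `infinityVector` and cannot change sign on the connected
punctured plane. -/
theorem dotProduct_normForm_pos {n n' : ℕ} {p q : Fin (m + 1) → ℝ[X]}
    (hp : IsMonicTuple n p) (hq : IsMonicTuple n' q)
    (h : ∀ v, normForm n p v ⬝ᵥ normForm n' q v ≠ 0) (v : Punctured 2) :
    0 < normForm n p v ⬝ᵥ normForm n' q v := by
  by_contra hn
  obtain ⟨w, hw⟩ := mem_range_of_exists_le_of_exists_ge
    (continuous_dotProduct_apply (normForm n p) (normForm n' q)) (c := 0)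
    ⟨v, not_lt.1 hn⟩ ⟨infinityVector, by
      rw [dotProduct_normForm_infinityVector hp hq]; positivity⟩
  exact h w hw

/-- At the negative of `infinityVector` the dot product has sign `(-1) ^ (n + n')`, yet it must be
positive. -/
theorem even_add_of_dotProduct_ne_zero {n n' : ℕ} {p q : Fin (m + 1) → ℝ[X]}
    (hp : IsMonicTuple n p) (hq : IsMonicTuple n' q)
    (h : ∀ v, normForm n p v ⬝ᵥ normForm n' q v ≠ 0) : Even (n + n') := by
  by_contra hn
  rw [Nat.not_even_iff_odd] at hn
  have hpos := dotProduct_normForm_pos hp hq h ⟨-infinityVector.1, neg_ne_zero.2 infinityVector.2⟩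
  have e {k : ℕ} {s : Fin (m + 1) → ℝ[X]} (hs : IsMonicTuple k s) :
      normForm k s ⟨-infinityVector.1, neg_ne_zero.2 infinityVector.2⟩ = fun _ => (-1) ^ k := by
    ext i
    rw [normForm_apply, homEval_of_eq_zero _ _ (by simp [infinityVector]), hs.coeff_eq_one]
    simp [infinityVector, planeNorm]
  rw [e hp, e hq] at hpos
  simp only [dotProduct, ← pow_add, hn.neg_one_pow, Finset.sum_const, Finset.card_univ,
    Fintype.card_fin, nsmul_eq_mul] at hpos
  push_cast at hpos
  nlinarith [Nat.cast_nonneg (α := ℝ) m]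

theorem dist_apply_le (f g : LoopSpace m) (z : RP 1) : dist (f.1 z) (g.1 z) ≤ dist f g :=
  ContinuousMap.dist_apply_le_dist z

theorem even_add_of_dist_le_one {n n' : ℕ} {f g : LoopSpace m} (hf : f ∈ RRat n m)
    (hg : g ∈ RRat n' m) (h : dist f g ≤ 1) : Even (n + n') := by
  obtain ⟨p, hp, hp0, rfl⟩ := exists_polyLoop_of_mem_RRat hf
  obtain ⟨q, hq, hq0, rfl⟩ := exists_polyLoop_of_mem_RRat hg
  refine even_add_of_dotProduct_ne_zero hp hq fun v =>
    dotProduct_ne_zero_of_dist_le_one (hp0 v) (hq0 v) ?_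
  have := (dist_apply_le _ _ (Projectivization.mk' ℝ v)).trans h
  rwa [polyLoop_mk', polyLoop_mk'] at this

/-- The normalized tuples of monic polynomials of degree `n` whose loop is `r`-close to `f`. -/
def nearForms (n : ℕ) (f : LoopSpace m) (r : ℝ) : Set C(Punctured 2, Fin (m + 1) → ℝ) :=
  {Φ | ∃ p, IsMonicTuple n p ∧ Φ = normForm n p ∧ ∀ v, ∃ h : Φ v ≠ 0,
    dist (Projectivization.mk ℝ (Φ v) h : RP m) (f.1 (Projectivization.mk' ℝ v)) < r}

/-- Two forms `1 / 2`-close to `f` are at distance at most `1` from each other, so their dot product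
never vanishes and is therefore positive; the cone lemma then applies pointwise. -/
theorem convex_nearForms (n : ℕ) (f : LoopSpace m) {r : ℝ} (hr : r ≤ 1 / 2) :
    Convex ℝ (nearForms n f r) := by
  rintro _ ⟨p, hp, rfl, hpf⟩ _ ⟨q, hq, rfl, hqf⟩ a b ha hb hab
  have hne (v : Punctured 2) : normForm n p v ⬝ᵥ normForm n q v ≠ 0 := by
    obtain ⟨h₁, hd₁⟩ := hpf v
    obtain ⟨h₂, hd₂⟩ := hqf v
    refine dotProduct_ne_zero_of_dist_le_one h₁ h₂
      ((dist_triangle_right _ _ (f.1 (Projectivization.mk' ℝ v))).trans ?_)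
    linarith
  refine ⟨a • p + b • q, hp.convexCombo hq hab, smul_normForm_add n p q a b, fun v => ?_⟩
  obtain ⟨h₁, hd₁⟩ := hpf v
  obtain ⟨h₂, hd₂⟩ := hqf v
  rw [← Projectivization.mk_rep (f.1 (Projectivization.mk' ℝ v))] at hd₁ hd₂ ⊢
  exact dist_mk_convexCombo_lt _ h₁ h₂ (dotProduct_normForm_pos hp hq hne v) (by linarith)
    hd₁ hd₂ ha hb hab

/-! ### Lifting loops to vector-valued functions on the real line -/

/-- The orthogonal projection of `w` to the line `x`. -/
noncomputable def projectTo (x : RP m) (w : Fin (m + 1) → ℝ) : Fin (m + 1) → ℝ :=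
  fun i => ∑ j, veronese m x (i, j) * w j

theorem continuous_projectTo :
    Continuous fun z : RP m × (Fin (m + 1) → ℝ) => projectTo z.1 z.2 := by
  refine continuous_pi fun i => continuous_finsetSum _ fun j _ => ?_
  refine Continuous.mul ?_ ((continuous_apply j).comp continuous_snd)
  exact ((continuous_apply (i, j)).comp (PiLp.continuous_ofLp 2 _)).comp
    ((continuous_veronese m).comp continuous_fst)

theorem projectTo_mk {u : Fin (m + 1) → ℝ} (hu : u ≠ 0) (w : Fin (m + 1) → ℝ) :
    projectTo (Projectivization.mk ℝ u hu) w = ((u ⬝ᵥ w) / (u ⬝ᵥ u)) • u := by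
  ext i
  have h (j) : veronese m (Projectivization.mk ℝ u hu) (i, j) = u i * u j / (u ⬝ᵥ u) := rfl
  simp only [projectTo, h, Pi.smul_apply, smul_eq_mul]
  rw [dotProduct.eq_1 u w, Finset.sum_div, Finset.sum_mul]
  exact Finset.sum_congr rfl fun j _ => by ring

theorem mk_projectTo {x : RP m} {w : Fin (m + 1) → ℝ} (hw : w ≠ 0)
    (h : dist x (Projectivization.mk ℝ w hw) ≤ 1) :
    ∃ h0 : projectTo x w ≠ 0, Projectivization.mk ℝ (projectTo x w) h0 = x := by
  induction x using Projectivization.ind with | h u hu => ?_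
  have h1 := dotProduct_ne_zero_of_dist_le_one hu hw h
  have h2 : (u ⬝ᵥ w) / (u ⬝ᵥ u) ≠ 0 := div_ne_zero h1 (dotProduct_self_pos hu).ne'
  have e := projectTo_mk hu w
  exact ⟨by rw [e]; exact smul_ne_zero h2 hu,
    (Projectivization.mk_eq_mk_iff' _ _ _ _ _).2 ⟨_, e.symm⟩⟩

/-- Paths in projective space lift to nowhere vanishing paths of vectors. -/
theorem exists_path_lift {c : ℝ → RP m} (hc : Continuous c) (a b : ℝ) :
    ∃ L : ℝ → Fin (m + 1) → ℝ, Continuous L ∧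
      ∀ s ∈ Icc a b, ∃ h : L s ≠ 0, Projectivization.mk ℝ (L s) h = c s := by
  obtain ⟨δ, hδ, hd⟩ := Metric.uniformContinuousOn_iff.1
    (isCompact_Icc.uniformContinuousOn_of_continuous (s := Icc a b) hc.continuousOn) 1 one_pos
  -- Induction lifts the path stopped at time `a + k * (δ / 2)`. Each step projects the current
  -- vector to the new line, which is too close to the old one for the projection to vanish.
  have key (k : ℕ) : ∃ L : ℝ → Fin (m + 1) → ℝ, Continuous L ∧
      ∀ s ∈ Icc a b, ∃ h : L s ≠ 0,
        Projectivization.mk ℝ (L s) h = c (min s (a + k * (δ / 2))) := by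
    induction k with
    | zero =>
      refine ⟨fun _ => (c a).rep, continuous_const, fun s hs => ⟨(c a).rep_nonzero, ?_⟩⟩
      rw [Projectivization.mk_rep, Nat.cast_zero, zero_mul, add_zero, min_eq_right hs.1]
    | succ k ih =>
      obtain ⟨L, hL, h⟩ := ih
      refine ⟨fun s => projectTo (c (min s (a + (k + 1 : ℕ) * (δ / 2)))) (L s),
        continuous_projectTo.comp ((hc.comp (continuous_id.min continuous_const)).prodMk hL),
        fun s hs => ?_⟩
      obtain ⟨h0, h1⟩ := h s hs
      refine mk_projectTo h0 ?_
      rw [h1]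
      have hk : 0 ≤ (k : ℝ) * (δ / 2) := by positivity
      push_cast
      refine (hd _ ⟨le_min hs.1 (by nlinarith), (min_le_left _ _).trans hs.2⟩ _
        ⟨le_min hs.1 (by linarith), (min_le_left _ _).trans hs.2⟩ ?_).le
      refine (abs_min_sub_min_le_max _ _ _ _).trans_lt ?_
      rw [sub_self, abs_zero, max_lt_iff]
      refine ⟨hδ, ?_⟩
      rw [show a + (k + 1) * (δ / 2) - (a + k * (δ / 2)) = δ / 2 by ring, abs_of_pos] <;> linarith
  obtain ⟨k, hk⟩ := exists_nat_gt ((b - a) / (δ / 2))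
  rw [div_lt_iff₀ (by positivity)] at hk
  obtain ⟨L, hL, h⟩ := key k
  refine ⟨L, hL, fun s hs => ?_⟩
  obtain ⟨h0, h1⟩ := h s hs
  exact ⟨h0, by rw [h1, min_eq_left (by linarith [hs.2])]⟩

theorem tendsto_div_one_add_abs_atTop :
    Tendsto (fun x : ℝ => x / (1 + |x|)) atTop (𝓝 1) := by
  have h : Tendsto (fun x : ℝ => 1 - (1 + x)⁻¹) atTop (𝓝 (1 - 0)) :=
    tendsto_const_nhds.sub
      (tendsto_inv_atTop_zero.comp (tendsto_atTop_add_const_left _ 1 tendsto_id))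
  rw [sub_zero] at h
  refine h.congr' ?_
  filter_upwards [eventually_ge_atTop 0] with x hx
  rw [abs_of_nonneg hx]
  field_simp
  ring

theorem tendsto_div_one_add_abs_atBot :
    Tendsto (fun x : ℝ => x / (1 + |x|)) atBot (𝓝 (-1)) := by
  have h := (tendsto_div_one_add_abs_atTop.comp tendsto_neg_atBot_atTop).neg
  refine h.congr fun x => ?_
  simp [neg_div]

/-- A path that runs once through the projective line. -/
noncomputable def linePath (s : ℝ) : Punctured 2 :=
  ⟨![s, 1 - |s|], fun h => by
    have h0 : s = 0 := congrFun h 0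
    have h1 : 1 - |s| = 0 := congrFun h 1
    simp [h0] at h1⟩

theorem continuous_linePath : Continuous linePath := by
  refine Continuous.subtype_mk (continuous_pi fun i => ?_) _
  fin_cases i
  · exact continuous_id
  · exact continuous_const.sub continuous_abs

theorem mk'_linePath_div (x : ℝ) :
    Projectivization.mk' ℝ (linePath (x / (1 + |x|))) = affinePoint x := by
  have h : 0 < 1 + |x| := by positivity
  refine (Projectivization.mk_eq_mk_iff' _ _ _ _ _).2 ⟨(1 + |x|)⁻¹, ?_⟩
  ext i
  fin_cases i
  · simp [div_eq_inv_mul]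
  · simp only [abs_div, abs_of_pos h]
    simp
    field_simp
    ring

theorem mk'_linePath_of_abs_eq_one {s : ℝ} (hs : |s| = 1) :
    Projectivization.mk' ℝ (linePath s) = infinityPoint := by
  refine (Projectivization.mk_eq_mk_iff' _ _ _ _ _).2 ⟨s, ?_⟩
  ext i
  fin_cases i <;> simp [hs]

theorem eq_one_or_neg_one_of_mk_eq_basePoint {w : Fin (m + 1) → ℝ} (hw : w ≠ 0)
    (hn : w ⬝ᵥ w = m + 1) (h : Projectivization.mk ℝ w hw = basePoint m) :
    ∃ a : ℝ, (a = 1 ∨ a = -1) ∧ w = fun _ => a := by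
  obtain ⟨a, rfl⟩ := (Projectivization.mk_eq_mk_iff' _ _ _ _ _).1 h
  refine ⟨a, ?_, by ext; simp⟩
  rw [← sq_eq_one_iff]
  have hm : (m + 1 : ℝ) ≠ 0 := by positivity
  simp only [dotProduct, Pi.smul_apply, smul_eq_mul, mul_one, Finset.sum_const, Finset.card_univ,
    Fintype.card_fin, nsmul_eq_mul, Nat.cast_add, Nat.cast_one] at hn
  rw [sq]
  exact mul_left_cancel₀ hm (by rw [hn, mul_one])

/-- The squared length `m + 1` is that of `(1, …, 1)`, so both limits are this vector up to sign.
The sign at `+∞` is normalized away; `τ` then tells whether the lift closes up or ends at the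
antipode. -/
theorem exists_normalized_lift (f : LoopSpace m) :
    ∃ (F : ℝ → Fin (m + 1) → ℝ) (τ : ℝ), (τ = 1 ∨ τ = -1) ∧ Continuous F ∧
      (∀ x, F x ⬝ᵥ F x = m + 1) ∧
      (∀ x, ∃ h : F x ≠ 0, Projectivization.mk ℝ (F x) h = f.1 (affinePoint x)) ∧
      Tendsto F atTop (𝓝 fun _ => 1) ∧ Tendsto F atBot (𝓝 fun _ => τ) := by
  have hc : Continuous fun s => f.1 (Projectivization.mk' ℝ (linePath s)) :=
    f.1.continuous.comp ((isOpenQuotientMap_mk' 1).continuous.comp continuous_linePath)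
  obtain ⟨L, hL, hLc⟩ := exists_path_lift hc (-1) 1
  let N : ℝ → Fin (m + 1) → ℝ := fun s => (√(m + 1) / √(L s ⬝ᵥ L s)) • L s
  have hpos {s : ℝ} (hs : s ∈ Icc (-1 : ℝ) 1) : 0 < √(L s ⬝ᵥ L s) :=
    Real.sqrt_pos.2 (dotProduct_self_pos (hLc s hs).1)
  have hm : 0 < √(m + 1 : ℝ) := Real.sqrt_pos.2 (by positivity)
  have hNc {s : ℝ} (hs : s ∈ Icc (-1 : ℝ) 1) : ContinuousAt N s := by
    have hLL : Continuous fun s => √(L s ⬝ᵥ L s) :=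
      Real.continuous_sqrt.comp (continuous_finsetSum _ fun i _ =>
        ((continuous_apply i).comp hL).mul ((continuous_apply i).comp hL))
    exact (continuousAt_const.div hLL.continuousAt (hpos hs).ne').smul hL.continuousAt
  have hNN {s : ℝ} (hs : s ∈ Icc (-1 : ℝ) 1) : N s ⬝ᵥ N s = m + 1 := by
    have h1 := Real.mul_self_sqrt (dotProduct_self_pos (hLc s hs).1).le
    have h2 := Real.mul_self_sqrt (show (0 : ℝ) ≤ m + 1 by positivity)
    simp only [N, smul_dotProduct, dotProduct_smul, smul_eq_mul]
    have h3 := (hpos hs).ne'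
    calc _ = (√(m + 1 : ℝ) * √(m + 1 : ℝ)) * (L s ⬝ᵥ L s) /
          (√(L s ⬝ᵥ L s) * √(L s ⬝ᵥ L s)) := by field_simp
      _ = m + 1 := by
        rw [h1, h2, mul_div_cancel_right₀ _ (dotProduct_self_pos (hLc s hs).1).ne']
  have hNf {s : ℝ} (hs : s ∈ Icc (-1 : ℝ) 1) (a : ℝ) (ha : a ≠ 0) : ∃ h : a • N s ≠ 0,
      Projectivization.mk ℝ (a • N s) h = f.1 (Projectivization.mk' ℝ (linePath s)) := by
    obtain ⟨h0, h1⟩ := hLc s hs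
    have hne : a * (√(m + 1 : ℝ) / √(L s ⬝ᵥ L s)) ≠ 0 :=
      mul_ne_zero ha (div_ne_zero hm.ne' (hpos hs).ne')
    have e : a • N s = (a * (√(m + 1 : ℝ) / √(L s ⬝ᵥ L s))) • L s := smul_smul _ _ _
    exact ⟨by rw [e]; exact smul_ne_zero hne h0,
      ((Projectivization.mk_eq_mk_iff' _ _ _ _ _).2 ⟨_, e.symm⟩).trans h1⟩
  have hend {s : ℝ} (hs : |s| = 1) : ∃ a : ℝ, (a = 1 ∨ a = -1) ∧ N s = fun _ => a := by
    have hs' : s ∈ Icc (-1 : ℝ) 1 := abs_le.1 hs.le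
    obtain ⟨h0, h1⟩ := hNf hs' 1 one_ne_zero
    simp only [one_smul] at h0 h1
    refine eq_one_or_neg_one_of_mk_eq_basePoint h0 (hNN hs') ?_
    rw [h1, mk'_linePath_of_abs_eq_one hs, f.2]
  obtain ⟨a, ha, haN⟩ := hend (s := 1) abs_one
  obtain ⟨b, hb, hbN⟩ := hend (s := -1) (by rw [abs_neg, abs_one])
  have haa : a * a = 1 := by rcases ha with rfl | rfl <;> norm_num
  have hx (x : ℝ) : x / (1 + |x|) ∈ Icc (-1 : ℝ) 1 := by
    have h : 0 < 1 + |x| := by positivity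
    refine abs_le.1 ?_
    rw [abs_div, abs_of_pos h, div_le_one h]
    linarith
  refine ⟨fun x => a • N (x / (1 + |x|)), a * b, ?_, ?_, fun x => ?_, fun x => ?_, ?_, ?_⟩
  · rcases ha with rfl | rfl <;> rcases hb with rfl | rfl <;> norm_num
  · refine Continuous.const_smul (continuous_iff_continuousAt.2 fun x => ?_) a
    have hdiv : Continuous fun x : ℝ => x / (1 + |x|) :=
      continuous_id.div (continuous_const.add continuous_abs) fun x => by positivity
    exact ContinuousAt.comp (f := fun x : ℝ => x / (1 + |x|)) (hNc (hx x)) hdiv.continuousAt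
  · rw [smul_dotProduct, dotProduct_smul, hNN (hx x), smul_eq_mul, smul_eq_mul, ← mul_assoc, haa,
      one_mul]
  · rw [← mk'_linePath_div x]
    exact hNf (hx x) a (by rintro rfl; simp at haa)
  · have h := ((hNc (s := 1) (by norm_num)).tendsto.comp tendsto_div_one_add_abs_atTop).const_smul a
    rw [haN] at h
    have e : (a • fun _ => a : Fin (m + 1) → ℝ) = fun _ => 1 := funext fun _ => haa
    rw [e] at h
    exact h
  · have h := ((hNc (s := -1) (by norm_num)).tendsto.comp
      tendsto_div_one_add_abs_atBot).const_smul a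
    rw [hbN] at h
    exact h

/-! ### Density of rational loops by Stone-Weierstrass -/

theorem natDegree_X_sq_add_one_pow (k : ℕ) : ((X ^ 2 + 1 : ℝ[X]) ^ k).natDegree = 2 * k := by
  rw [natDegree_pow, natDegree_X_sq_add_one, mul_comm]

theorem coeff_X_sq_add_one_pow (k : ℕ) : ((X ^ 2 + 1 : ℝ[X]) ^ k).coeff (2 * k) = 1 := by
  rw [← natDegree_X_sq_add_one_pow]
  exact monic_X_sq_add_one.pow k

/-- `c` is the value at infinity and `g` is the restriction to the real line of the function
`P / (x ^ 2 + 1) ^ k` on the projective line. -/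
def IsFraction (g : ℝ → ℝ) (c : ℝ) (k : ℕ) (P : ℝ[X]) : Prop :=
  P.natDegree ≤ 2 * k ∧ P.coeff (2 * k) = c ∧ ∀ x, g x * (x ^ 2 + 1) ^ k = P.eval x

theorem IsFraction.raise {g : ℝ → ℝ} {c : ℝ} {k : ℕ} {P : ℝ[X]} (h : IsFraction g c k P) (j : ℕ) :
    IsFraction g c (k + j) (P * (X ^ 2 + 1) ^ j) := by
  refine ⟨?_, ?_, fun x => ?_⟩
  · rw [mul_add]
    exact natDegree_mul_le_of_le h.1 (natDegree_X_sq_add_one_pow j).le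
  · rw [mul_add, coeff_mul_add_eq_of_natDegree_le h.1 (natDegree_X_sq_add_one_pow j).le, h.2.1,
      coeff_X_sq_add_one_pow, mul_one]
  · simp [← h.2.2 x, pow_add, mul_assoc]

theorem IsFraction.mul {g g' : ℝ → ℝ} {c c' : ℝ} {k k' : ℕ} {P P' : ℝ[X]}
    (h : IsFraction g c k P) (h' : IsFraction g' c' k' P') :
    IsFraction (fun x => g x * g' x) (c * c') (k + k') (P * P') := by
  refine ⟨?_, ?_, fun x => ?_⟩
  · rw [mul_add]
    exact natDegree_mul_le_of_le h.1 h'.1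
  · rw [mul_add, coeff_mul_add_eq_of_natDegree_le h.1 h'.1, h.2.1, h'.2.1]
  · rw [eval_mul, ← h.2.2 x, ← h'.2.2 x]
    ring

theorem IsFraction.add {g g' : ℝ → ℝ} {c c' : ℝ} {k : ℕ} {P P' : ℝ[X]}
    (h : IsFraction g c k P) (h' : IsFraction g' c' k P') :
    IsFraction (fun x => g x + g' x) (c + c') k (P + P') := by
  refine ⟨natDegree_add_le_of_degree_le h.1 h'.1, ?_, fun x => ?_⟩
  · rw [coeff_add, h.2.1, h'.2.1]
  · rw [eval_add, ← h.2.2 x, ← h'.2.2 x]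
    ring

theorem isFraction_const (c : ℝ) : IsFraction (fun _ => c) c 0 (C c) :=
  ⟨by simp, by simp, by simp⟩

/-- The algebra of fractions with denominator a power of `x ^ 2 + 1` on the projective line. -/
def fractionSubalgebra : Subalgebra ℝ C(OnePoint ℝ, ℝ) where
  carrier := {g | ∃ k P, IsFraction (fun x => g x) (g OnePoint.infty) k P}
  mul_mem' := by
    rintro g g' ⟨k, P, h⟩ ⟨k', P', h'⟩
    exact ⟨_, _, h.mul h'⟩
  add_mem' := by
    rintro g g' ⟨k, P, h⟩ ⟨k', P', h'⟩
    have h'' := h'.raise k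
    rw [add_comm] at h''
    exact ⟨_, _, (h.raise k').add h''⟩
  algebraMap_mem' c := ⟨_, _, isFraction_const c⟩

theorem tendsto_zero_cocompact_of_mul_le {g : ℝ → ℝ} (h : ∀ x, |g x| * |x| ≤ 1) :
    Tendsto g (cocompact ℝ) (𝓝 0) := by
  have hx := tendsto_norm_cocompact_atTop (E := ℝ)
  refine squeeze_zero_norm' ?_ (tendsto_inv_atTop_zero.comp hx)
  filter_upwards [hx.eventually_gt_atTop 0] with x h0
  rw [Function.comp_apply, ← one_div, le_div_iff₀ h0]
  exact h x

theorem exists_mem_fractionSubalgebra {P : ℝ[X]} (hP : P.natDegree ≤ 1)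
    (h : ∀ x, |P.eval x / (x ^ 2 + 1)| * |x| ≤ 1) :
    ∃ g ∈ fractionSubalgebra, g OnePoint.infty = 0 ∧ ∀ x : ℝ, g x = P.eval x / (x ^ 2 + 1) := by
  have hc : Continuous fun x : ℝ => P.eval x / (x ^ 2 + 1) :=
    P.continuous.div (by fun_prop) fun x => by positivity
  refine ⟨OnePoint.continuousMapMk ⟨_, hc⟩ 0 ?_, ⟨1, P, ?_, ?_, fun x => ?_⟩, rfl, fun x => rfl⟩
  · rw [coclosedCompact_eq_cocompact]
    exact tendsto_zero_cocompact_of_mul_le h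
  · linarith
  · exact coeff_eq_zero_of_natDegree_lt (by linarith)
  · have : x ^ 2 + 1 ≠ 0 := by positivity
    change P.eval x / (x ^ 2 + 1) * (x ^ 2 + 1) ^ 1 = _
    field_simp

/-- The function `1 / (x ^ 2 + 1)` separates infinity from real points, and real points up to sign;
`x / (x ^ 2 + 1)` separates the opposite ones. -/
theorem separatesPoints_fractionSubalgebra : fractionSubalgebra.SeparatesPoints := by
  obtain ⟨g, hg, hg0, hgx⟩ := exists_mem_fractionSubalgebra (P := 1) (by simp) fun x => by
    have h : 0 < x ^ 2 + 1 := by positivity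
    rw [eval_one, abs_div, abs_one, abs_of_pos h, div_mul_eq_mul_div, div_le_one h]
    nlinarith [sq_abs x, sq_nonneg (|x| - 1)]
  obtain ⟨k, hk, hk0, hkx⟩ := exists_mem_fractionSubalgebra (P := X) (by simp) fun x => by
    have h : 0 < x ^ 2 + 1 := by positivity
    rw [eval_X, abs_div, abs_of_pos h, div_mul_eq_mul_div, div_le_one h]
    nlinarith [sq_abs x]
  have hpos (x : ℝ) : g x ≠ 0 := by
    rw [hgx, eval_one]
    positivity
  intro x y hxy
  by_cases h : g x = g y
  · refine ⟨k, ⟨k, hk, rfl⟩, fun hk' => hxy ?_⟩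
    induction x using OnePoint.rec with
    | infty =>
      induction y using OnePoint.rec with
      | infty => rfl
      | coe y => exact absurd (h.symm.trans hg0) (hpos y)
    | coe x =>
      induction y using OnePoint.rec with
      | infty => exact absurd (h.trans hg0) (hpos x)
      | coe y =>
        have hx : x ^ 2 + 1 ≠ 0 := by positivity
        have hy : y ^ 2 + 1 ≠ 0 := by positivity
        rw [hgx, hgx, eval_one, eval_one, div_eq_div_iff hx hy, one_mul, one_mul] at h
        rw [hkx, hkx, eval_X, eval_X, h, div_left_inj' hx] at hk'
        rw [hk']
  · exact ⟨g, ⟨g, hg, rfl⟩, h⟩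

/-- Continuous functions on the projective line are uniform limits of fractions with the same
value at infinity. -/
theorem exists_isFraction_near {φ : ℝ → ℝ} (hφ : Continuous φ) {c : ℝ}
    (ht : Tendsto φ atTop (𝓝 c)) (hb : Tendsto φ atBot (𝓝 c)) {ε : ℝ} (hε : 0 < ε) :
    ∃ g k P, IsFraction g c k P ∧ ∀ x, |g x - φ x| < ε := by
  have hlim : Tendsto φ (coclosedCompact ℝ) (𝓝 c) := by
    rw [coclosedCompact_eq_cocompact, cocompact_eq_atBot_atTop]
    exact hb.sup ht
  let f : C(OnePoint ℝ, ℝ) := OnePoint.continuousMapMk ⟨φ, hφ⟩ c hlim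
  obtain ⟨⟨g, k, P, hg⟩, hd⟩ :=
    ContinuousMap.exists_mem_subalgebra_near_continuous_of_separatesPoints fractionSubalgebra
      separatesPoints_fractionSubalgebra f f.continuous (ε / 2) (half_pos hε)
  -- Adding this constant corrects the value at infinity, at the cost of the second `ε / 2`.
  have hconst := (isFraction_const (c - g OnePoint.infty)).raise k
  rw [zero_add] at hconst
  have hsum := hg.add hconst
  rw [add_sub_cancel] at hsum
  refine ⟨_, _, _, hsum, fun x => ?_⟩
  have hx : |g x - φ x| < ε / 2 := hd x
  have hinf : |g OnePoint.infty - c| < ε / 2 := hd OnePoint.infty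
  rw [abs_lt] at hx hinf ⊢
  constructor <;> linarith

/-- A version of the approximation theorem with a common denominator. -/
theorem exists_isFraction_near_pi {ι : Type*} [Fintype ι] {φ : ι → ℝ → ℝ}
    (hφ : ∀ i, Continuous (φ i)) {c : ℝ} (ht : ∀ i, Tendsto (φ i) atTop (𝓝 c))
    (hb : ∀ i, Tendsto (φ i) atBot (𝓝 c)) {ε : ℝ} (hε : 0 < ε) :
    ∃ N : ℕ, ∀ k ≥ N, ∀ i, ∃ g P, IsFraction g c k P ∧ ∀ x, |g x - φ i x| < ε := by
  choose g k P h hd using fun i => exists_isFraction_near (hφ i) (ht i) (hb i) hε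
  refine ⟨∑ i, k i, fun K hK i => ?_⟩
  obtain ⟨j, rfl⟩ := Nat.exists_eq_add_of_le
    ((Finset.single_le_sum (fun i _ => Nat.zero_le (k i)) (Finset.mem_univ i)).trans hK)
  exact ⟨_, _, (h i).raise j, hd i⟩

theorem tendsto_div_sqrt_atTop : Tendsto (fun x : ℝ => x / √(x ^ 2 + 1)) atTop (𝓝 1) := by
  have h : Tendsto (fun x : ℝ => (√(1 + x⁻¹ ^ 2))⁻¹) atTop (𝓝 (√(1 + 0 ^ 2))⁻¹) := by
    refine Tendsto.inv₀ (Real.continuous_sqrt.continuousAt.tendsto.comp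
      (tendsto_const_nhds.add (tendsto_inv_atTop_zero.pow 2))) ?_
    norm_num
  simp only [ne_eq, OfNat.ofNat_ne_zero, not_false_eq_true, zero_pow, add_zero, Real.sqrt_one,
    inv_one] at h
  refine h.congr' ?_
  filter_upwards [eventually_gt_atTop 0] with x hx
  have e : x ^ 2 + 1 = x ^ 2 * (1 + x⁻¹ ^ 2) := by field_simp
  rw [e, Real.sqrt_mul (sq_nonneg x), Real.sqrt_sq hx.le]
  have : 0 < √(1 + x⁻¹ ^ 2) := Real.sqrt_pos.2 (by positivity)
  field_simp

theorem tendsto_div_sqrt_atBot : Tendsto (fun x : ℝ => x / √(x ^ 2 + 1)) atBot (𝓝 (-1)) := by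
  refine (tendsto_div_sqrt_atTop.comp tendsto_neg_atBot_atTop).neg.congr fun x => ?_
  simp [neg_div]

theorem tendsto_inv_sqrt_cocompact :
    Tendsto (fun x : ℝ => (√(x ^ 2 + 1))⁻¹) (cocompact ℝ) (𝓝 0) := by
  refine tendsto_zero_cocompact_of_mul_le fun x => ?_
  have h : 0 < √(x ^ 2 + 1) := Real.sqrt_pos.2 (by positivity)
  rw [abs_of_pos (inv_pos.2 h), inv_mul_le_one₀ h]
  exact Real.abs_le_sqrt (by linarith)

/-- For `τ = 1` even degree works directly. For `τ = -1`, the products of `F` with `x / √(x ^ 2 +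
1)` and `1 / √(x ^ 2 + 1)` have equal limits at both ends, namely `1` and `0`. Approximating them by
`P` and `Q` over a common denominator and recombining, since the squares of the two factors sum to
`1`, gives the odd-degree tuple `P * X + Q`. -/
theorem exists_isMonicTuple_near {F : ℝ → Fin (m + 1) → ℝ} (hF : Continuous F) {τ : ℝ}
    (hτ : τ = 1 ∨ τ = -1) (ht : Tendsto F atTop (𝓝 fun _ => 1))
    (hb : Tendsto F atBot (𝓝 fun _ => τ)) {ε : ℝ} (hε : 0 < ε) :
    ∃ n p, IsMonicTuple n p ∧ ∀ x i, |normForm n p (affineVector x) i - F x i| < ε := by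
  have hFi (i) : Continuous fun x => F x i := (continuous_apply i).comp hF
  have hti (i) : Tendsto (fun x => F x i) atTop (𝓝 1) := tendsto_pi_nhds.1 ht i
  have hbi (i) : Tendsto (fun x => F x i) atBot (𝓝 τ) := tendsto_pi_nhds.1 hb i
  have hpos (x : ℝ) : 0 < √(x ^ 2 + 1) := Real.sqrt_pos.2 (by positivity)
  have hsq (x : ℝ) : √(x ^ 2 + 1) ^ 2 = x ^ 2 + 1 := Real.sq_sqrt (by positivity)
  have hsc : Continuous fun x : ℝ => √(x ^ 2 + 1) := by fun_prop
  rcases hτ with rfl | rfl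
  · obtain ⟨k, hk⟩ := exists_isFraction_near_pi hFi hti hbi hε
    choose g P h hd using hk k le_rfl
    have hP : IsMonicTuple (2 * k) P := isMonicTuple_of_coeff fun i => ⟨(h i).1, (h i).2.1⟩
    refine ⟨2 * k, P, hP, fun x i => ?_⟩
    rw [normForm_affineVector hP, Pi.smul_apply, smul_eq_mul, ← (h i).2.2 x, pow_mul, hsq]
    have : x ^ 2 + 1 ≠ 0 := by positivity
    convert hd i x using 3
    field_simp
  · have hinv : Tendsto (fun x : ℝ => (√(x ^ 2 + 1))⁻¹) (atBot ⊔ atTop) (𝓝 0) := by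
      rw [← cocompact_eq_atBot_atTop]
      exact tendsto_inv_sqrt_cocompact
    obtain ⟨N, hN⟩ := exists_isFraction_near_pi (φ := fun i x => x / √(x ^ 2 + 1) * F x i) (c := 1)
      (fun i => (continuous_id.div hsc fun x => (hpos x).ne').mul (hFi i))
      (fun i => by simpa using tendsto_div_sqrt_atTop.mul (hti i))
      (fun i => by simpa using tendsto_div_sqrt_atBot.mul (hbi i)) (half_pos hε)
    obtain ⟨N', hN'⟩ := exists_isFraction_near_pi (φ := fun i x => (√(x ^ 2 + 1))⁻¹ * F x i) (c := 0)
      (fun i => (hsc.inv₀ fun x => (hpos x).ne').mul (hFi i))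
      (fun i => by simpa using (hinv.mono_left le_sup_right).mul (hti i))
      (fun i => by simpa using (hinv.mono_left le_sup_left).mul (hbi i)) (half_pos hε)
    choose g P h hd using hN (N + N') (Nat.le_add_right _ _)
    choose g' Q h' hd' using hN' (N + N') (Nat.le_add_left _ _)
    set k := N + N'
    have hP : IsMonicTuple (2 * k + 1) fun i => P i * X + Q i := by
      refine isMonicTuple_of_coeff fun i => ⟨?_, ?_⟩
      · exact natDegree_add_le_of_degree_le (natDegree_mul_le_of_le (h i).1 natDegree_X_le)
          ((h' i).1.trans (Nat.le_succ _))
      · rw [coeff_add, coeff_mul_X, (h i).2.1,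
          coeff_eq_zero_of_natDegree_lt (Nat.lt_succ_of_le (h' i).1), add_zero]
    refine ⟨2 * k + 1, _, hP, fun x i => ?_⟩
    have hs := hpos x
    have hx : x ^ 2 + 1 ≠ 0 := by positivity
    have e : normForm (2 * k + 1) (fun i => P i * X + Q i) (affineVector x) i - F x i =
        x / √(x ^ 2 + 1) * (g i x - x / √(x ^ 2 + 1) * F x i) +
          (√(x ^ 2 + 1))⁻¹ * (g' i x - (√(x ^ 2 + 1))⁻¹ * F x i) := by
      have e1 : (x / √(x ^ 2 + 1)) ^ 2 + (√(x ^ 2 + 1))⁻¹ ^ 2 = 1 := by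
        rw [div_pow, inv_pow, hsq]
        field_simp
      have e2 : normForm (2 * k + 1) (fun i => P i * X + Q i) (affineVector x) i =
          x / √(x ^ 2 + 1) * g i x + (√(x ^ 2 + 1))⁻¹ * g' i x := by
        rw [normForm_affineVector hP, Pi.smul_apply, smul_eq_mul]
        simp only [eval_add, eval_mul, eval_X]
        rw [← (h i).2.2 x, ← (h' i).2.2 x, pow_succ, pow_mul, hsq]
        field_simp
      rw [e2]
      linear_combination F x i * e1
    have hb1 : |x / √(x ^ 2 + 1)| ≤ 1 := by
      rw [abs_div, abs_of_pos hs, div_le_one hs]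
      exact Real.abs_le_sqrt (by linarith)
    have hb2 : |(√(x ^ 2 + 1))⁻¹| ≤ 1 := by
      rw [abs_of_pos (inv_pos.2 hs)]
      exact inv_le_one_of_one_le₀ (Real.one_le_sqrt.2 (by nlinarith [sq_nonneg x]))
    rw [e]
    refine (abs_add_le _ _).trans_lt ?_
    rw [abs_mul, abs_mul]
    have l1 := (mul_le_of_le_one_left (abs_nonneg _) hb1).trans_lt (hd i x)
    have l2 := (mul_le_of_le_one_left (abs_nonneg _) hb2).trans_lt (hd' i x)
    linarith

/-- The bound on `ε` keeps `w` at least half as long as `u`, so the squared sine of the angle is at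
most `4 * ε ^ 2` and the squared distance at most `8 * ε ^ 2 < (3 * ε) ^ 2`. -/
theorem dist_mk_lt_of_near {u w : Fin (m + 1) → ℝ} (hu : u ≠ 0) (hn : u ⬝ᵥ u = m + 1) {ε : ℝ}
    (hε : 0 < ε) (hε' : ε ≤ 1 / 2) (h : ∀ i, |w i - u i| < ε) :
    ∃ hw : w ≠ 0, dist (Projectivization.mk ℝ w hw : RP m) (Projectivization.mk ℝ u hu) < 3 * ε := by
  have hd : (w - u) ⬝ᵥ (w - u) ≤ (m + 1) * ε ^ 2 := by
    calc (w - u) ⬝ᵥ (w - u) ≤ ∑ _i : Fin (m + 1), ε ^ 2 := by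
          refine Finset.sum_le_sum fun i _ => ?_
          rw [← sq, Pi.sub_apply]
          exact sq_le_sq' (abs_lt.1 (h i)).1.le (abs_lt.1 (h i)).2.le
      _ = (m + 1) * ε ^ 2 := by simp
  have hpar : u ⬝ᵥ u ≤ 2 * (w ⬝ᵥ w) + 2 * ((w - u) ⬝ᵥ (w - u)) := by
    simp only [dotProduct, Finset.mul_sum, ← Finset.sum_add_distrib]
    refine Finset.sum_le_sum fun i _ => ?_
    simp only [Pi.sub_apply]
    nlinarith [sq_nonneg (2 * w i - u i)]
  have hm : (0 : ℝ) < m + 1 := by positivity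
  have hε2 : ε ^ 2 ≤ 1 / 4 := by nlinarith
  have hww : (m + 1) / 4 ≤ w ⬝ᵥ w := by nlinarith
  have hw : w ≠ 0 := by
    rintro rfl
    rw [zero_dotProduct] at hww
    linarith
  refine ⟨hw, (dist_mk_lt_iff hw hu (by positivity)).2 ?_⟩
  have hcs := dotProduct_sq_le u (w - u)
  have hgram : (w ⬝ᵥ w) * (u ⬝ᵥ u) - (w ⬝ᵥ u) ^ 2 =
      (u ⬝ᵥ u) * ((w - u) ⬝ᵥ (w - u)) - (u ⬝ᵥ (w - u)) ^ 2 := by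
    simp only [sub_dotProduct, dotProduct_sub, dotProduct_comm u w]
    ring
  have hle : (u ⬝ᵥ u) * ((w - u) ⬝ᵥ (w - u)) ≤ (u ⬝ᵥ u) * ((m + 1) * ε ^ 2) :=
    mul_le_mul_of_nonneg_left hd (by rw [hn]; exact hm.le)
  have hwu : (m + 1) / 4 * (m + 1) ≤ (w ⬝ᵥ w) * (u ⬝ᵥ u) := by
    rw [hn]
    exact mul_le_mul_of_nonneg_right hww hm.le
  rw [hn] at hle
  nlinarith [sq_nonneg (u ⬝ᵥ (w - u)), mul_le_mul_of_nonneg_left hwu (sq_nonneg ε),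
    mul_pos (mul_pos hm hm) (pow_pos hε 2)]

/-- Rational loops are dense in the loop space. -/
theorem exists_mem_RRat_dist_lt (hm : 1 ≤ m) (f : LoopSpace m) {δ : ℝ} (hδ : 0 < δ) :
    ∃ n, ∃ g ∈ RRat n m, dist g f < δ := by
  obtain ⟨F, τ, hτ, hF, hn, hmk, ht, hb⟩ := exists_normalized_lift f
  -- Half of `δ` pays for the polynomial approximation, the other half for removing common complex
  -- roots.
  obtain ⟨ε, hε, hε'⟩ : ∃ ε : ℝ, 0 < ε ∧ ε ≤ 1 / 2 ∧ 3 * ε ≤ δ / 2 :=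
    ⟨min (1 / 2) (δ / 6), by positivity, min_le_left _ _,
      by linarith [min_le_right (1 / 2 : ℝ) (δ / 6)]⟩
  obtain ⟨n, p, hp, hd⟩ := exists_isMonicTuple_near hF hτ ht hb hε
  have hnear (x : ℝ) := dist_mk_lt_of_near (hmk x).1 (hn x) hε hε'.1 (hd x)
  have h0 : ∀ v, normForm n p v ≠ 0 := normForm_ne_zero hp fun x => by
    have := (hnear x).1
    rw [normForm_affineVector hp] at this
    exact Function.ne_iff.1 (right_ne_zero_of_smul this)
  have hfd : dist (polyLoop n p hp h0) f ≤ δ / 2 := by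
    rw [Subtype.dist_eq]
    refine (ContinuousMap.dist_le (by positivity)).2 fun z => ?_
    obtain rfl | ⟨x, rfl⟩ := eq_infinityPoint_or_affinePoint z
    · rw [f.2, (polyLoop n p hp h0).2, dist_self]
      positivity
    · rw [← (hmk x).2]
      exact (hnear x).2.le.trans hε'.2
  obtain ⟨g, hg, hgd⟩ := Metric.mem_closure_iff.1 (polyLoop_mem_rat hm hp h0) (δ / 2) (half_pos hδ)
  refine ⟨n, g, hg, (dist_triangle_left _ _ (polyLoop n p hp h0)).trans_lt ?_⟩
  linarith

/-! ### Least approximating degree and continuous selection -/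

theorem isLift_of_mem_nearForms {n : ℕ} {f : LoopSpace m} {r : ℝ}
    {Φ : C(Punctured 2, Fin (m + 1) → ℝ)} (h : Φ ∈ nearForms n f r) : IsLift Φ := by
  obtain ⟨p, hp, rfl, hd⟩ := h
  exact isLift_normForm hp fun v => (hd v).1

theorem toLoop_mem_rat (hm : 1 ≤ m) {n : ℕ} {f : LoopSpace m} {r : ℝ}
    {Φ : C(Punctured 2, Fin (m + 1) → ℝ)} (h : Φ ∈ nearForms n f r) :
    toLoop ⟨Φ, isLift_of_mem_nearForms h⟩ ∈ rat n m := by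
  obtain ⟨p, hp, rfl, hd⟩ := id h
  exact polyLoop_mem_rat hm hp fun v => (hd v).1

theorem dist_toLoop_le {n : ℕ} {f : LoopSpace m} {r : ℝ} (hr : 0 ≤ r)
    {Φ : C(Punctured 2, Fin (m + 1) → ℝ)} (h : Φ ∈ nearForms n f r) :
    dist (toLoop ⟨Φ, isLift_of_mem_nearForms h⟩) f ≤ r := by
  rw [Subtype.dist_eq]
  refine (ContinuousMap.dist_le hr).2 fun z => ?_
  obtain ⟨v, rfl⟩ := (isOpenQuotientMap_mk' 1).surjective z
  obtain ⟨p, hp, rfl, hd⟩ := id h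
  exact (hd v).2.le

theorem mem_nearForms_of_dist_lt {n k : ℕ} {p : Fin (m + 1) → ℝ[X]} (hp : IsMonicTuple n p)
    (h0 : ∀ v, normForm n p v ≠ 0) {f : LoopSpace m} {r : ℝ} (h : dist (polyLoop n p hp h0) f < r) :
    normForm n p ∈ nearForms (n + 2 * k) f r := by
  obtain ⟨q, hq, e⟩ := normForm_mul_X_sq_add_one_pow hp k
  refine ⟨q, hq, e.symm, fun v => ⟨h0 v, ?_⟩⟩
  have := (dist_apply_le _ _ (Projectivization.mk' ℝ v)).trans_lt h
  rwa [polyLoop_mk'] at this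

/-- The least degree of a rational loop that is `δ`-close to `f`. -/
noncomputable def approxDegree (f : LoopSpace m) (δ : ℝ) : ℕ :=
  sInf {n | ∃ g ∈ RRat n m, dist g f < δ}

theorem approxDegree_spec (hm : 1 ≤ m) (f : LoopSpace m) {δ : ℝ} (hδ : 0 < δ) :
    ∃ g ∈ RRat (approxDegree f δ) m, dist g f < δ :=
  Nat.sInf_mem (s := {n | ∃ g ∈ RRat n m, dist g f < δ}) (exists_mem_RRat_dist_lt hm f hδ)

theorem approxDegree_le {f g : LoopSpace m} {δ : ℝ} {n : ℕ} (hg : g ∈ RRat n m)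
    (h : dist g f < δ) : approxDegree f δ ≤ n :=
  Nat.sInf_le ⟨g, hg, h⟩

theorem exists_eq_add_two_mul {a b : ℕ} (h : a ≤ b) (he : Even (a + b)) : ∃ k, b = a + 2 * k := by
  obtain ⟨c, hc⟩ := he
  exact ⟨c - a, by omega⟩

/-- This is why the deformation preserves each stage: a degree `n` approximant bounds the least
degree, and lies within `2 * δ ≤ 1` of an approximant of least degree, so parities agree. -/
theorem approxDegree_of_mem_rat (hm : 1 ≤ m) {f : LoopSpace m} {δ : ℝ} (hδ : 0 < δ)
    (hδ' : δ ≤ 1 / 2) {n : ℕ} (hf : f ∈ rat n m) : ∃ k, n = approxDegree f δ + 2 * k := by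
  obtain ⟨g, hg, hgf⟩ := Metric.mem_closure_iff.1 hf δ hδ
  rw [dist_comm] at hgf
  obtain ⟨g', hg', hgf'⟩ := approxDegree_spec hm f hδ
  refine exists_eq_add_two_mul (approxDegree_le hg hgf) (even_add_of_dist_le_one hg' hg ?_)
  linarith [dist_triangle_right g' g f]

/-- The form chosen for `f₀` at radius `t₀ / 4` serves all nearby `(f, t)`: a loop `t / 8`-close to
`f` is `t₀ / 4`-close to `f₀`, so the required degree can only rise, by an even amount, while `t₀ /
4 + t₀ / 16 < t / 2`. -/
theorem exists_eventually_mem_nearForms (hm : 1 ≤ m) (f₀ : LoopSpace m) {t₀ : ℝ} (ht₀ : 0 < t₀)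
    (ht₀' : t₀ ≤ 1) : ∃ Φ, ∀ f t, dist f f₀ < t₀ / 16 → |t - t₀| < t₀ / 16 →
      Φ ∈ nearForms (approxDegree f (t / 8)) f (t / 2) := by
  obtain ⟨g₀, hg₀, hd₀⟩ := approxDegree_spec hm f₀ (δ := t₀ / 4) (by positivity)
  obtain ⟨p, hp, h0, rfl⟩ := exists_polyLoop_of_mem_RRat hg₀
  refine ⟨normForm (approxDegree f₀ (t₀ / 4)) p, fun f t hf ht => ?_⟩
  obtain ⟨ht1, ht2⟩ := abs_lt.1 ht
  obtain ⟨g, hg, hd⟩ := approxDegree_spec hm f (δ := t / 8) (by linarith)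
  have h1 : dist g f₀ < t₀ / 4 := by linarith [dist_triangle g f f₀]
  obtain ⟨k, hk⟩ := exists_eq_add_two_mul (approxDegree_le hg h1)
    (even_add_of_dist_le_one hg₀ hg ((dist_triangle_right _ _ f₀).trans (by linarith)))
  rw [hk]
  refine mem_nearForms_of_dist_lt hp h0 ?_
  exact (dist_triangle_right _ _ f₀).trans_lt (by linarith)

/-- Locally constant choices are glued by a partition of unity on a metric space, convexity keeping
the result admissible. -/
theorem exists_continuous_mem_nearForms (hm : 1 ≤ m) :
    ∃ g : C(LoopSpace m × Ioc (0 : ℝ) 1, C(Punctured 2, Fin (m + 1) → ℝ)),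
      ∀ x, g x ∈ nearForms (approxDegree x.1 (x.2 / 8)) x.1 (x.2 / 2) := by
  refine exists_continuous_forall_mem_convex_of_local_const
    (fun x => convex_nearForms _ _ (by linarith [x.2.2.2])) fun x => ?_
  obtain ⟨Φ, hΦ⟩ := exists_eventually_mem_nearForms hm x.1 x.2.2.1 x.2.2.2
  have hpos : 0 < (x.2 : ℝ) / 16 := by linarith [x.2.2.1]
  refine ⟨Φ, ?_⟩
  filter_upwards [Metric.ball_mem_nhds x hpos] with y hy
  rw [Metric.mem_ball, Prod.dist_eq, max_lt_iff] at hy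
  exact hΦ y.1 y.2 hy.1 hy.2

theorem exists_rational_approximation (hm : 1 ≤ m) :
    ∃ P : C(LoopSpace m × Ioc (0 : ℝ) 1, LoopSpace m),
      (∀ x, P x ∈ rat (approxDegree x.1 ((x.2 : ℝ) / 8)) m) ∧
        ∀ x, dist (P x) x.1 ≤ (x.2 : ℝ) / 2 := by
  obtain ⟨g, hg⟩ := exists_continuous_mem_nearForms hm
  refine ⟨⟨fun x => toLoop ⟨g x, isLift_of_mem_nearForms (hg x)⟩,
    continuous_toLoop.comp (g.continuous.subtype_mk _)⟩, fun x => ?_, fun x => ?_⟩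
  · exact toLoop_mem_rat hm (hg x)
  · exact dist_toLoop_le (by linarith [x.2.2.1]) (hg x)

/-! ### The deformation and the homotopy equivalence -/

/-- There is a deformation of the loop space that preserves all spaces of rational maps and moves
every loop to a rational loop at all positive times. -/
theorem exists_deformation (hm : 1 ≤ m) : ∃ H : C(unitInterval × LoopSpace m, LoopSpace m),
    (∀ f, H (0, f) = f) ∧
      ∀ (t : unitInterval) f, 0 < (t : ℝ) → H (t, f) ∈ rat (approxDegree f ((t : ℝ) / 8)) m := by
  obtain ⟨P, hP, hPd⟩ := exists_rational_approximation hm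
  let F : unitInterval × LoopSpace m → LoopSpace m := fun x =>
    if h : 0 < (x.1 : ℝ) then P (x.2, ⟨x.1, h, x.1.2.2⟩) else x.2
  have hF0 (f : LoopSpace m) : F (0, f) = f := by simp [F]
  have hFd (x) : dist (F x) x.2 ≤ (x.1 : ℝ) / 2 := by
    by_cases h : 0 < (x.1 : ℝ)
    · simp only [F, h, dif_pos]
      exact hPd _
    · simp only [F, h, dif_neg, not_false_eq_true, dist_self]
      linarith [x.1.2.1]
  have hFpos (t : unitInterval) (f : LoopSpace m) (h : 0 < (t : ℝ)) :
      F (t, f) ∈ rat (approxDegree f ((t : ℝ) / 8)) m := by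
    simp only [F, h, dif_pos]
    exact hP (f, ⟨t, h, t.2.2⟩)
  have hFc : Continuous F := by
    rw [continuous_iff_continuousAt]
    rintro ⟨t, f⟩
    by_cases h : 0 < (t : ℝ)
    · have ho : IsOpen {x : unitInterval × LoopSpace m | 0 < (x.1 : ℝ)} :=
        isOpen_lt continuous_const (continuous_subtype_val.comp continuous_fst)
      refine ContinuousOn.continuousAt (s := {x | 0 < (x.1 : ℝ)}) ?_ (ho.mem_nhds h)
      rw [continuousOn_iff_continuous_domRestrict]
      have : Set.domRestrict {x | 0 < (x.1 : ℝ)} F =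
          fun x => P (x.1.2, ⟨x.1.1, x.2, x.1.1.2.2⟩) := by
        ext1 x
        exact dif_pos x.2
      rw [this]
      exact P.continuous.comp (by fun_prop)
    · have ht : t = 0 := Subtype.ext (le_antisymm (not_lt.1 h) t.2.1)
      subst ht
      -- At time `0` continuity comes from the bound `t / 2` on the displacement alone; the degrees
      -- may be unbounded.
      rw [ContinuousAt, hF0, tendsto_iff_dist_tendsto_zero]
      have hlim : Tendsto (fun x : unitInterval × LoopSpace m => (x.1 : ℝ) / 2 + dist x.2 f)
          (𝓝 (0, f)) (𝓝 0) := by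
        have : Continuous fun x : unitInterval × LoopSpace m => (x.1 : ℝ) / 2 + dist x.2 f := by
          fun_prop
        simpa using this.tendsto (0, f)
      exact squeeze_zero (fun _ => dist_nonneg)
        (fun x => (dist_triangle _ x.2 _).trans (add_le_add_left (hFd x) _)) hlim
  exact ⟨⟨F, hFc⟩, hF0, hFpos⟩

namespace SeqLimit

variable {X : Type*} [TopologicalSpace X] {A : ℕ → Set X}

theorem continuous_of (k : ℕ) : Continuous (of A k) :=
  continuous_iff_coinduced_le.2 (le_iSup (fun k => TopologicalSpace.coinduced (of A k) _) k)

theorem ext {X : Type*} {A : ℕ → Set X} {x y : SeqLimit A} (h : val x = val y) : x = y := Subtype.ext h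

/-- The deformation of the direct limit induced by a deformation of the ambient space that
preserves all stages. -/
def deformation (H : C(unitInterval × X, X)) (hH : ∀ k t, ∀ x ∈ A k, H (t, x) ∈ A k) :
    C(SeqLimit A, C(unitInterval, SeqLimit A)) where
  toFun x :=
    { toFun := fun t => ⟨H (t, x.1), x.2.imp fun k hk => hH k t x.1 hk⟩
      continuous_toFun := by
        obtain ⟨k, hk⟩ := x.2
        exact (continuous_of k).comp (Continuous.subtype_mk
          (f := fun t => H (t, x.1)) (by fun_prop) fun t => hH k t x.1 hk) }
  continuous_toFun := by
    -- In curried form, continuity is checked stage by stage, with no need to compare the product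
    -- with the interval to a direct limit of products.
    refine continuous_iSup_dom.2 fun k => continuous_coinduced_dom.2 ?_
    refine ContinuousMap.continuous_of_continuous_uncurry _ ?_
    exact (continuous_of k).comp (Continuous.subtype_mk
      (f := fun z : A k × unitInterval => H (z.2, z.1.1)) (by fun_prop)
      fun z => hH k z.2 z.1.1 z.1.2)

end SeqLimit

/-- An approximant `g₀` of `f₀` stays `δ`-close to all nearby `f`, so its degree bounds theirs with
the same parity. -/
theorem exists_eventually_approxDegree_eq (hm : 1 ≤ m) (f₀ : LoopSpace m) {δ : ℝ} (hδ : 0 < δ)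
    (hδ' : δ ≤ 1 / 2) : ∃ n, ∀ᶠ f in 𝓝 f₀, ∃ k, n = approxDegree f δ + 2 * k := by
  obtain ⟨g₀, hg₀, hd₀⟩ := approxDegree_spec hm f₀ hδ
  refine ⟨approxDegree f₀ δ, ?_⟩
  have : ∀ᶠ f in 𝓝 f₀, dist g₀ f < δ :=
    (continuous_const.dist continuous_id).continuousAt.eventually_lt continuousAt_const hd₀
  filter_upwards [this] with f hf
  obtain ⟨g, hg, hd⟩ := approxDegree_spec hm f hδ
  exact exists_eq_add_two_mul (approxDegree_le hg₀ hf)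
    (even_add_of_dist_le_one hg hg₀ ((dist_triangle_right _ _ f).trans (by linarith)))

/-- The rational approximation of loops, as a map to the stabilized space of rational maps. -/
theorem exists_approximation (hm : 1 ≤ m) {h : C(LoopSpace m, LoopSpace m)}
    (hh : ∀ f, h f ∈ rat (approxDegree f (1 / 8)) m) :
    ∃ G : C(LoopSpace m, RatInfinity m), (∀ f, ratInclusion m (G f) = h f) ∧
      (∀ k, ∀ f ∈ rat (2 * k) m, ∃ x, G f = Sum.inl x) ∧
      (∀ k, ∀ f ∈ rat (2 * k + 1) m, ∃ x, G f = Sum.inr x) := by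
  have hev {f : LoopSpace m} (he : Even (approxDegree f (1 / 8))) :
      h f ∈ rat (2 * (approxDegree f (1 / 8) / 2)) m := by
    rw [Nat.two_mul_div_two_of_even he]; exact hh f
  have hodd {f : LoopSpace m} (he : ¬ Even (approxDegree f (1 / 8))) :
      h f ∈ rat (2 * (approxDegree f (1 / 8) / 2) + 1) m := by
    rw [Nat.two_mul_div_two_add_one_of_odd (Nat.not_even_iff_odd.1 he)]; exact hh f
  let G : LoopSpace m → RatInfinity m := fun f =>
    if he : Even (approxDegree f (1 / 8)) then Sum.inl ⟨h f, _, hev he⟩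
    else Sum.inr ⟨h f, _, hodd he⟩
  have hGc : Continuous G := by
    rw [continuous_iff_continuousAt]
    intro f₀
    obtain ⟨n, hn⟩ := exists_eventually_approxDegree_eq hm f₀ (δ := 1 / 8) (by norm_num)
      (by norm_num)
    -- On this neighbourhood `h` takes values in the single stage `rat n m`, through which `G`
    -- factors.
    refine ContinuousOn.continuousAt (s := {f | ∃ k, n = approxDegree f (1 / 8) + 2 * k}) ?_ hn
    rw [continuousOn_iff_continuous_domRestrict]
    have hU (f : {f : LoopSpace m | ∃ k, n = approxDegree f (1 / 8) + 2 * k}) : h f ∈ rat n m := by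
      obtain ⟨f, k, rfl⟩ := f
      exact rat_subset_rat_add_two_mul hm _ k (hh f)
    obtain ⟨c, rfl | rfl⟩ := Nat.even_or_odd' n
    · have e : Set.domRestrict {f | ∃ k, 2 * c = approxDegree f (1 / 8) + 2 * k} G =
          fun f : {f : LoopSpace m | ∃ k, 2 * c = approxDegree f (1 / 8) + 2 * k} =>
          Sum.inl (SeqLimit.of (fun k => rat (2 * k) m) c ⟨h f, hU f⟩) := by
        ext1 ⟨f, k, hk⟩
        exact dif_pos (Nat.even_iff.2 (show approxDegree f (1 / 8) % 2 = 0 by omega))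
      rw [e]
      exact continuous_inl.comp ((SeqLimit.continuous_of c).comp
        ((h.continuous.comp continuous_subtype_val).subtype_mk hU))
    · have e : Set.domRestrict {f | ∃ k, 2 * c + 1 = approxDegree f (1 / 8) + 2 * k} G =
          fun f : {f : LoopSpace m | ∃ k, 2 * c + 1 = approxDegree f (1 / 8) + 2 * k} =>
          Sum.inr (SeqLimit.of (fun k => rat (2 * k + 1) m) c ⟨h f, hU f⟩) := by
        ext1 ⟨f, k, hk⟩
        exact dif_neg (Nat.not_even_iff.2 (show approxDegree f (1 / 8) % 2 = 1 by omega))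
      rw [e]
      exact continuous_inr.comp ((SeqLimit.continuous_of c).comp
        ((h.continuous.comp continuous_subtype_val).subtype_mk hU))
  refine ⟨⟨G, hGc⟩, fun f => ?_, fun k f hf => ?_, fun k f hf => ?_⟩
  · change Sum.elim SeqLimit.val SeqLimit.val (G f) = h f
    by_cases he : Even (approxDegree f (1 / 8))
    · simp only [G, he, dif_pos]; rfl
    · simp only [G, he, dif_neg, not_false_eq_true]; rfl
  · obtain ⟨j, hj⟩ := approxDegree_of_mem_rat hm (δ := 1 / 8) (by norm_num) (by norm_num) hf
    exact ⟨_, dif_pos (Nat.even_iff.2 (by omega))⟩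
  · obtain ⟨j, hj⟩ := approxDegree_of_mem_rat hm (δ := 1 / 8) (by norm_num) (by norm_num) hf
    exact ⟨_, dif_neg (Nat.not_even_iff.2 (by omega))⟩

theorem exists_homotopyEquiv_ratInclusion (hm : 1 ≤ m) :
    ∃ e : RatInfinity m ≃ₕ LoopSpace m, e.toFun = ratInclusion m := by
  obtain ⟨H, H0, Hpos⟩ := exists_deformation hm
  have hrat (n : ℕ) (t : unitInterval) (f : LoopSpace m) (hf : f ∈ rat n m) :
      H (t, f) ∈ rat n m := by
    rcases t.2.1.eq_or_lt with h | h
    · have : t = 0 := Subtype.ext h.symm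
      rwa [this, H0]
    · obtain ⟨k, hk⟩ := approxDegree_of_mem_rat hm (δ := (t : ℝ) / 8) (by positivity)
        (by linarith [t.2.2]) hf
      rw [hk]
      exact rat_subset_rat_add_two_mul hm _ k (Hpos t f h)
  let h : C(LoopSpace m, LoopSpace m) := ⟨fun f => H (1, f), by fun_prop⟩
  obtain ⟨G, hG, hGev, hGodd⟩ := exists_approximation hm (h := h) fun f => by
    have := Hpos 1 f (by simp)
    rwa [Set.Icc.coe_one] at this
  let Kev := SeqLimit.deformation (A := fun k => rat (2 * k) m) H fun k => hrat (2 * k)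
  let Kodd := SeqLimit.deformation (A := fun k => rat (2 * k + 1) m) H fun k => hrat (2 * k + 1)
  let K : RatInfinity m → C(unitInterval, RatInfinity m) :=
    Sum.elim (fun x => ContinuousMap.comp ⟨Sum.inl, continuous_inl⟩ (Kev x))
      (fun x => ContinuousMap.comp ⟨Sum.inr, continuous_inr⟩ (Kodd x))
  have hK : Continuous K :=
    ((ContinuousMap.continuous_postcomp _).comp Kev.continuous).sumElim
      ((ContinuousMap.continuous_postcomp _).comp Kodd.continuous)
  have hK' : Continuous fun z : unitInterval × RatInfinity m => K z.2 z.1 :=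
    (hK.comp continuous_snd).eval continuous_fst
  refine ⟨⟨ratInclusion m, G, ?_, ?_⟩, rfl⟩
  · refine ContinuousMap.Homotopic.symm ⟨⟨⟨fun z => K z.2 z.1, hK'⟩, ?_, ?_⟩⟩
    · rintro (x | x)
      · exact congrArg Sum.inl (SeqLimit.ext (H0 x.1))
      · exact congrArg Sum.inr (SeqLimit.ext (H0 x.1))
    · rintro (x | x)
      · obtain ⟨k, hk⟩ := x.2
        obtain ⟨y, hy⟩ := hGev k x.1 hk
        have := hG x.1
        rw [hy] at this
        exact (congrArg Sum.inl (SeqLimit.ext (x := Kev x 1) (y := y) this.symm)).trans hy.symm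
      · obtain ⟨k, hk⟩ := x.2
        obtain ⟨y, hy⟩ := hGodd k x.1 hk
        have := hG x.1
        rw [hy] at this
        exact (congrArg Sum.inr (SeqLimit.ext (x := Kodd x 1) (y := y) this.symm)).trans hy.symm
  · refine ContinuousMap.Homotopic.symm ⟨⟨H, H0, fun f => (hG f).symm⟩⟩

end RationalLoops

theorem mainTheorem3 (m : ℕ) (hm : 1 ≤ m) :
    ∃ e : RationalLoops.RatInfinity m ≃ₕ RationalLoops.LoopSpace m,
      e.toFun = RationalLoops.ratInclusion m := by
  exact RationalLoops.exists_homotopyEquiv_ratInclusion hm
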